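/- Let $\Omega\subset\mathbb C$ be open and connected and let $a,b$ be analytic in $\Omega$ and such that $\Omega_+=\{z\in\Omega : |b(z)|<|a(z)|\}$ and $\Omega_-=\{z\in\Omega : |b(z)|>|a(z)|\}$ are both nonempty. Let $\mathcal C$ and $\mathcal D$ be complex Pontryagin spaces with the same index of negativity, let $U\subset\Omega_+$ be open, let $\alpha\in U$, and let $S$ be a function from $U$ to the space $\mathbf L(\mathcal D,\mathcal C)$ of continuous linear operators. Put $\sigma=b/a$ and $$b_\sigma(z)=\frac{\sigma(z)-\sigma(\alpha)}{1-\sigma(z)\overline{\sigma(\alpha)}} .$$ Adjoints are taken with respect to the indefinite inner products. Call $S$ a generalized Schur function with $\kappa$ negative squares if $S$ is analytic in $U$ and the kernel $$K_S(z,w)=\frac{I_{\mathcal C}-S(z)S(w)^*}{a(z)\overline{a(w)}-b(z)\overline{b(w)}},\qquad z,w\in U,$$ has exactly $\kappa$ negative squares in $U$. This means that $K_S(z,w)=K_S(w,z)^*$ and that the Hermitian matrices $\big([K_S(w_\ell,w_k)c_k,c_\ell]_{\mathcal C}\big)_{\ell,k=1}^N$, with $N\in\mathbb N$, $w_j\in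 U$ and $c_j\in\mathcal C$, have at most $\kappa$ strictly negative eigenvalues (counted with multiplicity), and exactly $\kappa$ for some choice of $N$, $w_j$, $c_j$. Say that $S$ has a coisometric realization of index $\kappa$ if there are a Pontryagin space $\mathcal P$ with index of negativity $\kappa$ and a coisometric operator matrix $$\begin{pmatrix}T&F\\ G&H\end{pmatrix}:\ \mathcal P\oplus\mathcal D\longrightarrow\mathcal P\oplus\mathcal C$$ such that, for every $z\in U$, the operator $I_{\mathcal P}-b_\sigma(z)T$ is invertible and $$S(z)=H+b_\sigma(z)\,G\,(I_{\mathcal P}-b_\sigma(z)T)^{-1}F .$$ Then $S$ is a generalized Schur function (with some finite number of negative squares) if and only if it has a coisometric realization of some finite index. Moreover, for every $\kappa\in\{0,1,2,\dots\}$, $S$ is a generalized Schur function with exactly $\kappa$ negative squares if and only if $\kappa$ is the smallest index of a coisometric realization of $S$; in particular, a generalized Schur function with $\kappa$ negative squares has a coisometric realization of index $\kappa$. -/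

import Mathlib

open scoped ComplexConjugate

universe u v w

/-- A Pontryagin space: a complex vector space `V` with a Hermitian form `[x, y]` (linear in `x`,
antilinear in `y`) and a fundamental decomposition `V = V₊ [+] V₋`, with `V₋` finite-dimensional.
The space `V` is topologized by the Hilbert norm of this decomposition,
`‖x + y‖² = [x, x] - [y, y]` for `x ∈ V₊` and `y ∈ V₋`
(so the form is positive definite on `V₊` and negative definite on `V₋`). The norms of any two
fundamental decompositions are equivalent, so continuity and analyticity do not depend on
the decomposition. -/
class PontryaginSpace (V : Type*) [NormedAddCommGroup V] [InnerProductSpace ℂ V]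
    [CompleteSpace V] where
  /-- the indefinite inner product -/
  form : V →ₗ[ℂ] V →ₗ⋆[ℂ] ℂ
  form_conj_symm : ∀ x y, conj (form x y) = form y x
  /-- the positive part of the fundamental decomposition -/
  pos : Submodule ℂ V
  /-- the negative part of the fundamental decomposition -/
  neg : Submodule ℂ V
  isCompl : IsCompl pos neg
  form_pos_neg : ∀ x ∈ pos, ∀ y ∈ neg, form x y = 0
  norm_sq : ∀ x ∈ pos, ∀ y ∈ neg, ((‖x + y‖ ^ 2 : ℝ) : ℂ) = form x x - form y y
  finiteDimensional_neg : FiniteDimensional ℂ neg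

namespace PontryaginSpace

section Basic

variable (V : Type*) [NormedAddCommGroup V] [InnerProductSpace ℂ V] [CompleteSpace V]
  [PontryaginSpace V]

/-- The index (of negativity) of a Pontryagin space, `dim V₋`. -/
noncomputable def negIndex : ℕ := Module.finrank ℂ (neg (V := V))

instance : FiniteDimensional ℂ (neg (V := V)) := finiteDimensional_neg

/-- The fundamental symmetry `J (x + y) = x - y` for `x ∈ V₊`, `y ∈ V₋`; it is written with the
Hilbert space orthogonal projection onto `V₋` because `V₊` and `V₋` are orthogonal also in the
Hilbert space inner product. -/
noncomputable def fundamentalSymmetry : V →L[ℂ] V :=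
  ContinuousLinearMap.id ℂ V - (2 : ℂ) • (neg (V := V)).starProjection

variable {V}

theorem exists_decomposition (x : V) :
    ∃ y ∈ pos (V := V), ∃ z ∈ neg (V := V), y + z = x := by
  refine Submodule.mem_sup.1 ?_
  rw [(isCompl (V := V)).sup_eq_top]
  exact Submodule.mem_top

theorem form_neg_pos {x y : V} (hx : x ∈ neg (V := V)) (hy : y ∈ pos (V := V)) :
    form x y = 0 := by
  rw [← form_conj_symm, form_pos_neg y hy x hx, map_zero]

theorem form_self_pos {x : V} (hx : x ∈ pos (V := V)) :
    form x x = ((‖x‖ ^ 2 : ℝ) : ℂ) := by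
  have := norm_sq x hx 0 (Submodule.zero_mem _)
  simpa using this.symm

theorem form_self_neg {x : V} (hx : x ∈ neg (V := V)) :
    form x x = -((‖x‖ ^ 2 : ℝ) : ℂ) := by
  have := norm_sq 0 (Submodule.zero_mem _) x hx
  simp only [zero_add, map_zero, zero_sub] at this
  rw [this, neg_neg]

/-- Two sesquilinear forms which agree on the diagonal of a subspace agree on the subspace. -/
theorem eq_of_diag {V : Type*} [NormedAddCommGroup V] [InnerProductSpace ℂ V]
    (p : Submodule ℂ V) (f g : V →ₗ[ℂ] V →ₗ⋆[ℂ] ℂ)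
    (h : ∀ x ∈ p, f x x = g x x) {x y : V} (hx : x ∈ p) (hy : y ∈ p) : f x y = g x y := by
  have hx' := h x hx
  have hy' := h y hy
  have h1 := h (x + y) (p.add_mem hx hy)
  have h2 := h (x + Complex.I • y) (p.add_mem hx (p.smul_mem _ hy))
  simp only [map_add, LinearMap.add_apply, map_smul, LinearMap.smul_apply, map_smulₛₗ,
    Complex.conj_I, smul_eq_mul] at h1 h2
  have hI : Complex.I * Complex.I = -1 := Complex.I_mul_I
  linear_combination (1 / 2 : ℂ) * h1 + (Complex.I / 2) * h2 -
    (1 / 2 : ℂ) * (1 + Complex.I) * hx' -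
    (1 / 2 : ℂ) * (1 - Complex.I * Complex.I * Complex.I) * hy' +
    (1 / 2 : ℂ) * (f x y - f y x - g x y + g y x) * hI

/-- The Hilbert space inner product, written linearly in the first variable. -/
noncomputable def hilbertForm {V : Type*} [NormedAddCommGroup V] [InnerProductSpace ℂ V] :
    V →ₗ[ℂ] V →ₗ⋆[ℂ] ℂ :=
  (innerₛₗ ℂ (E := V)).flip

theorem hilbertForm_apply {V : Type*} [NormedAddCommGroup V] [InnerProductSpace ℂ V] (x y : V) : hilbertForm x y = inner ℂ y x := rfl

theorem hilbertForm_self {V : Type*} [NormedAddCommGroup V] [InnerProductSpace ℂ V] (x : V) :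
    hilbertForm x x = ((‖x‖ ^ 2 : ℝ) : ℂ) := by
  rw [hilbertForm_apply, inner_self_eq_norm_sq_to_K]; push_cast; rfl

theorem inner_pos_neg {x y : V} (hx : x ∈ pos (V := V)) (hy : y ∈ neg (V := V)) :
    inner ℂ y x = 0 := by
  have key : ∀ y ∈ neg (V := V), inner ℂ y x + inner ℂ x y = 0 := by
    intro y hy
    have h := norm_sq x hx y hy
    rw [← hilbertForm_self, form_self_pos hx, form_self_neg hy, ← hilbertForm_self,
      ← hilbertForm_self] at h
    simp only [map_add, LinearMap.add_apply, hilbertForm_apply] at h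
    linear_combination h
  have h1 := key y hy
  have h2 := key (Complex.I • y) (Submodule.smul_mem _ _ hy)
  rw [inner_smul_left, inner_smul_right, Complex.conj_I] at h2
  have hI : Complex.I * Complex.I = -1 := Complex.I_mul_I
  linear_combination (1 / 2 : ℂ) * h1 + (Complex.I / 2) * h2 +
    (1 / 2 : ℂ) * (inner ℂ y x - inner ℂ x y) * hI

/-- The form is the Hilbert space inner product twisted by the fundamental symmetry. -/
theorem form_eq_inner (x y : V) : form x y = inner ℂ y (fundamentalSymmetry V x) := by
  obtain ⟨x₁, hx₁, x₂, hx₂, rfl⟩ := exists_decomposition x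
  obtain ⟨y₁, hy₁, y₂, hy₂, rfl⟩ := exists_decomposition y
  have hP : form x₁ y₁ = hilbertForm x₁ y₁ :=
    eq_of_diag pos _ _ (fun z hz => by rw [form_self_pos hz, hilbertForm_self]) hx₁ hy₁
  have hN : form x₂ y₂ = (-hilbertForm) x₂ y₂ :=
    eq_of_diag neg _ _ (fun z hz => by
      rw [form_self_neg hz, LinearMap.neg_apply, LinearMap.neg_apply, hilbertForm_self])
      hx₂ hy₂
  have p1 : (neg (V := V)).starProjection x₁ = 0 :=
    (Submodule.starProjection_apply_eq_zero_iff _).2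
      ((Submodule.mem_orthogonal _ _).2 fun z hz => inner_pos_neg hx₁ hz)
  have p2 : (neg (V := V)).starProjection x₂ = x₂ :=
    Submodule.starProjection_eq_self_iff.2 hx₂
  have c : inner ℂ y₁ x₂ = 0 := by
    rw [← inner_conj_symm, inner_pos_neg hy₁ hx₂, map_zero]
  simp only [fundamentalSymmetry, map_add, LinearMap.add_apply, hP, hN, LinearMap.neg_apply,
    hilbertForm_apply, form_pos_neg x₁ hx₁ y₂ hy₂, form_neg_pos hx₂ hy₁,
    _root_.sub_apply, ContinuousLinearMap.id_apply,
    _root_.smul_apply, p1, p2, inner_add_left, inner_add_right, inner_sub_right,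
    inner_smul_right, inner_pos_neg hx₁ hy₂, c, smul_zero, inner_zero_right]
  ring

theorem fundamentalSymmetry_apply_apply (x : V) :
    fundamentalSymmetry V (fundamentalSymmetry V x) = x := by
  have h : (neg (V := V)).starProjection ((neg (V := V)).starProjection x) =
      (neg (V := V)).starProjection x :=
    Submodule.starProjection_eq_self_iff.2 (Submodule.starProjection_apply_mem _ _)
  simp only [fundamentalSymmetry, _root_.sub_apply, ContinuousLinearMap.id_apply,
    _root_.smul_apply, map_sub, map_smul, h]
  module

/-- The form is nondegenerate. -/
theorem eq_of_form_eq {y y' : V} (h : ∀ x, form x y = form x y') : y = y' := by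
  refine ext_inner_right ℂ fun x => ?_
  have := h (fundamentalSymmetry V x)
  rwa [form_eq_inner, form_eq_inner, fundamentalSymmetry_apply_apply] at this

end Basic

section Adjoint

variable {V₁ V₂ : Type*}
  [NormedAddCommGroup V₁] [InnerProductSpace ℂ V₁] [CompleteSpace V₁] [PontryaginSpace V₁]
  [NormedAddCommGroup V₂] [InnerProductSpace ℂ V₂] [CompleteSpace V₂] [PontryaginSpace V₂]

/-- The Pontryagin space adjoint `A^*`, written with the Hilbert space adjoint `A†` as
`J₁ A† J₂`; it is characterized by `[A x, y] = [x, A^* y]`, see the next two theorems. -/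
noncomputable def adj (A : V₁ →L[ℂ] V₂) : V₂ →L[ℂ] V₁ :=
  fundamentalSymmetry V₁ ∘L ContinuousLinearMap.adjoint A ∘L fundamentalSymmetry V₂

theorem form_adj_right (A : V₁ →L[ℂ] V₂) (x : V₁) (y : V₂) :
    form (A x) y = form x (adj A y) := by
  rw [← form_conj_symm y (A x), ← form_conj_symm _ x, form_eq_inner, form_eq_inner, adj,
    ContinuousLinearMap.comp_apply, ContinuousLinearMap.comp_apply,
    fundamentalSymmetry_apply_apply, ContinuousLinearMap.adjoint_inner_right]

theorem adj_unique (A : V₁ →L[ℂ] V₂) (B : V₂ →L[ℂ] V₁)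
    (h : ∀ x y, form (A x) y = form x (B y)) : B = adj A := by
  ext y
  exact eq_of_form_eq fun x => by rw [← h, form_adj_right]

/-- `A` is coisometric: `A A^* = I`. -/
def IsCoisometry (A : V₁ →L[ℂ] V₂) : Prop :=
  A ∘L adj A = ContinuousLinearMap.id ℂ V₂

end Adjoint

section Sum

variable {V₁ V₂ : Type*}
  [NormedAddCommGroup V₁] [InnerProductSpace ℂ V₁] [CompleteSpace V₁] [PontryaginSpace V₁]
  [NormedAddCommGroup V₂] [InnerProductSpace ℂ V₂] [CompleteSpace V₂] [PontryaginSpace V₂]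

/-- The direct sum `V₁ ⊕ V₂` of Pontryagin spaces, with `[(x, y), (x', y')] = [x, x'] + [y, y']`. -/
noncomputable instance : PontryaginSpace (WithLp 2 (V₁ × V₂)) where
  form := LinearMap.mk₂'ₛₗ (RingHom.id ℂ) (starRingEnd ℂ)
    (fun x y => form x.fst y.fst + form x.snd y.snd)
    (by intros; simp; ring) (by intros; simp; ring)
    (by intros; simp; ring) (by intros; simp; ring)
  form_conj_symm x y := by
    simp [form_conj_symm]
  pos := ((pos (V := V₁)).prod (pos (V := V₂))).comap (WithLp.linearEquiv 2 ℂ (V₁ × V₂)).toLinearMap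
  neg := ((neg (V := V₁)).prod (neg (V := V₂))).comap (WithLp.linearEquiv 2 ℂ (V₁ × V₂)).toLinearMap
  isCompl := by
    constructor
    · rw [Submodule.disjoint_def]
      intro x hx hy
      have h1 := (Submodule.disjoint_def.1 (isCompl (V := V₁)).disjoint) x.fst hx.1 hy.1
      have h2 := (Submodule.disjoint_def.1 (isCompl (V := V₂)).disjoint) x.snd hx.2 hy.2
      exact WithLp.ofLp_injective 2 (Prod.ext h1 h2)
    · rw [codisjoint_iff, eq_top_iff]
      intro x _
      obtain ⟨x₁, hx₁, x₂, hx₂, hx⟩ := exists_decomposition x.fst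
      obtain ⟨y₁, hy₁, y₂, hy₂, hy⟩ := exists_decomposition x.snd
      exact Submodule.mem_sup.2 ⟨WithLp.toLp 2 (x₁, y₁), ⟨hx₁, hy₁⟩,
        WithLp.toLp 2 (x₂, y₂), ⟨hx₂, hy₂⟩, WithLp.ofLp_injective 2 (Prod.ext hx hy)⟩
  form_pos_neg x hx y hy := by
    have h1 := form_pos_neg x.fst hx.1 y.fst hy.1
    have h2 := form_pos_neg x.snd hx.2 y.snd hy.2
    simp [h1, h2]
  norm_sq x hx y hy := by
    have h1 := norm_sq x.fst hx.1 y.fst hy.1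
    have h2 := norm_sq x.snd hx.2 y.snd hy.2
    rw [WithLp.prod_norm_sq_eq_of_L2]
    simp only [WithLp.add_fst, WithLp.add_snd, LinearMap.mk₂'ₛₗ_apply]
    push_cast at h1 h2 ⊢
    rw [h1, h2]; ring
  finiteDimensional_neg := by
    have : FiniteDimensional ℂ ((neg (V := V₁)).prod (neg (V := V₂))) :=
      Module.Finite.iff_fg.2
        ((Module.Finite.iff_fg.1 finiteDimensional_neg).prod
          (Module.Finite.iff_fg.1 finiteDimensional_neg))
    exact Module.Finite.equiv
      ((WithLp.linearEquiv 2 ℂ (V₁ × V₂)).ofSubmodule' _).symm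

end Sum

end PontryaginSpace

open PontryaginSpace

section Colligation

variable {P C D : Type*}
  [NormedAddCommGroup P] [InnerProductSpace ℂ P]
  [NormedAddCommGroup C] [InnerProductSpace ℂ C]
  [NormedAddCommGroup D] [InnerProductSpace ℂ D]

/-- The operator matrix with rows `T F` and `G H`, from `P ⊕ D` to `P ⊕ C`. -/
noncomputable def colligation (T : P →L[ℂ] P) (F : D →L[ℂ] P) (G : P →L[ℂ] C) (H : D →L[ℂ] C) :
    WithLp 2 (P × D) →L[ℂ] WithLp 2 (P × C) :=
  (WithLp.prodContinuousLinearEquiv 2 ℂ P C).symm.toContinuousLinearMap ∘L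
    ((T.coprod F).prod (G.coprod H)) ∘L
    (WithLp.prodContinuousLinearEquiv 2 ℂ P D).toContinuousLinearMap

theorem colligation_apply (T : P →L[ℂ] P) (F : D →L[ℂ] P) (G : P →L[ℂ] C) (H : D →L[ℂ] C)
    (p : P) (d : D) :
    colligation T F G H (WithLp.toLp 2 (p, d)) = WithLp.toLp 2 (T p + F d, G p + H d) := rfl

end Colligation

section NegativeSquares

variable {C : Type*} [NormedAddCommGroup C] [InnerProductSpace ℂ C] [CompleteSpace C]
  [PontryaginSpace C]

/-- The matrix with `ℓ k` entry `[K(w_ℓ, w_k) c_k, c_ℓ]`. -/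
noncomputable def kernelMatrix (K : ℂ → ℂ → C →L[ℂ] C) {N : ℕ} (w : Fin N → ℂ) (c : Fin N → C) :
    Matrix (Fin N) (Fin N) ℂ :=
  Matrix.of fun l k => form (K (w l) (w k) (c k)) (c l)

theorem kernelMatrix_isHermitian {K : ℂ → ℂ → C →L[ℂ] C} {U : Set ℂ}
    (hK : ∀ z ∈ U, ∀ w ∈ U, K z w = adj (K w z)) {N : ℕ} {w : Fin N → ℂ} (hw : ∀ i, w i ∈ U)
    (c : Fin N → C) : (kernelMatrix K w c).IsHermitian := by
  ext l k
  simp only [kernelMatrix, Matrix.conjTranspose_apply, Matrix.of_apply, ← starRingEnd_apply]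
  rw [form_conj_symm, hK _ (hw l) _ (hw k), ← form_conj_symm, form_adj_right, form_conj_symm]

open Classical in
/-- The number of strictly negative eigenvalues of a Hermitian matrix, with multiplicity. -/
noncomputable def negEigenvalueCount {N : ℕ} {M : Matrix (Fin N) (Fin N) ℂ}
    (hM : M.IsHermitian) : ℕ :=
  (Finset.univ.filter fun i => hM.eigenvalues i < 0).card

/-- The kernel `K` has (exactly) `κ` negative squares in `U`. -/
structure HasNegativeSquares (K : ℂ → ℂ → C →L[ℂ] C) (U : Set ℂ) (κ : ℕ) : Prop where
  hermitian : ∀ z ∈ U, ∀ w ∈ U, K z w = adj (K w z)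
  count_le : ∀ (N : ℕ) (w : Fin N → ℂ) (hw : ∀ i, w i ∈ U) (c : Fin N → C),
    negEigenvalueCount (kernelMatrix_isHermitian hermitian hw c) ≤ κ
  exists_count_eq : ∃ (N : ℕ) (w : Fin N → ℂ) (hw : ∀ i, w i ∈ U) (c : Fin N → C),
    negEigenvalueCount (kernelMatrix_isHermitian hermitian hw c) = κ

end NegativeSquares

/-- `Ω₊ = {z ∈ Ω : |b(z)| < |a(z)|}`. -/
def omegaPlus (Ω : Set ℂ) (a b : ℂ → ℂ) : Set ℂ := {z ∈ Ω | ‖b z‖ < ‖a z‖}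

/-- `Ω₋ = {z ∈ Ω : |b(z)| > |a(z)|}`. -/
def omegaMinus (Ω : Set ℂ) (a b : ℂ → ℂ) : Set ℂ := {z ∈ Ω | ‖a z‖ < ‖b z‖}

/-- `b_σ(z) = (σ(z) - σ(α)) / (1 - σ(z) conj(σ(α)))` with `σ = b / a`. -/
noncomputable def bSigma (a b : ℂ → ℂ) (α z : ℂ) : ℂ :=
  (b z / a z - b α / a α) / (1 - b z / a z * conj (b α / a α))

section Schur

variable {C : Type u} {D : Type v}
  [NormedAddCommGroup C] [InnerProductSpace ℂ C] [CompleteSpace C] [PontryaginSpace C]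
  [NormedAddCommGroup D] [InnerProductSpace ℂ D] [CompleteSpace D] [PontryaginSpace D]

/-- `K_S(z, w) = (I - S(z) S(w)^*) / (a(z) conj(a(w)) - b(z) conj(b(w)))`. -/
noncomputable def schurKernel (a b : ℂ → ℂ) (S : ℂ → D →L[ℂ] C) (z w : ℂ) : C →L[ℂ] C :=
  (a z * conj (a w) - b z * conj (b w))⁻¹ •
    (ContinuousLinearMap.id ℂ C - S z ∘L adj (S w))

/-- `S` is analytic in `U` and `K_S` has exactly `κ` negative squares in `U`: the function `S` is
a generalized Schur function on `U`, with index `κ`. -/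
def IsGeneralizedSchur (a b : ℂ → ℂ) (U : Set ℂ) (S : ℂ → D →L[ℂ] C) (κ : ℕ) : Prop :=
  AnalyticOnNhd ℂ S U ∧ HasNegativeSquares (schurKernel a b S) U κ

/-- There are a Pontryagin space `P` of index `κ` and a coisometric operator matrix with rows `T F`
and `G H` such that, for every `z ∈ U`, the operator `I - b_σ(z) T` is boundedly invertible and
`S(z) = H + b_σ(z) G (I - b_σ(z) T)⁻¹ F`. -/
def HasCoisometricRealization (a b : ℂ → ℂ) (α : ℂ) (U : Set ℂ) (S : ℂ → D →L[ℂ] C)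
    (κ : ℕ) : Prop :=
  ∃ (P : Type w) (_ : NormedAddCommGroup P) (_ : InnerProductSpace ℂ P) (_ : CompleteSpace P)
    (_ : PontryaginSpace P) (T : P →L[ℂ] P) (F : D →L[ℂ] P) (G : P →L[ℂ] C) (H : D →L[ℂ] C),
    negIndex P = κ ∧ IsCoisometry (colligation T F G H) ∧
    ∀ z ∈ U, IsUnit (1 - bSigma a b α z • T) ∧
      S z = H + bSigma a b α z • (G ∘L Ring.inverse (1 - bSigma a b α z • T) ∘L F)

end Schur

/-! Write β for b_σ. A Möbius computation shows that K_S(z,w) equals φ(z) conj φ(w) times (I -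
S(z)S(w)^*) / (1 - β(z) conj β(w)) with φ zero-free on U. The factor can be absorbed into the
vectors c_j, so only this disk kernel K matters. On U one has |β| < 1 and β(α) = 0, and {β ≠ β(w)}
is dense in U for each w: otherwise b would be a(w)⁻¹b(w) times a on the connected set Ω, which is
impossible on Ω_-.

From kernel to realization: finitely supported functions on U × C, with the Hermitian form induced
by K, complete to a Pontryagin space P of index κ. It is generated by vectors k_w c with [k_w c, k_z
d] = [K(z,w)c, d] (`exists_completion`, `exists_kernelSpace`). Clearing the denominator in K says
exactly that (conj β(w) k_w c, c) ↦ (k_w c, S(w)^* c) is isometric from P ⊕ C to P ⊕ D. Its domain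
is dense, and the two spaces have equal index, so it is bounded and extends to an everywhere defined
isometry A (`exists_isometric_extension`). The adjoint of A is the coisometric operator matrix. A
Fredholm argument (`isUnit_one_sub_smul_adj`) reduces invertibility of I - β(z)T to injectivity,
which again follows from density of {β ≠ β(z)}. The formula for S is then read off from the action
of A on the generators.

From realization to kernel: if x_w c = (G(I - β(w)T)⁻¹)^* c, the adjoint matrix maps (conj β(w) x_w
c, c) to (x_w c, S(w)^* c). It is an isometry, so K is the Gram kernel of the x_w c, and its number
of negative squares is at most the index of the state space (`form_diskKernel_eq_of_realization`).
Minimality follows from combining both directions.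

Negative squares are handled throughout by negative systems, families with Gram matrix -1, whose
maximal length serves as the index of a form. -/

/-! ### Negative systems of Hermitian forms -/

section NegativeSystems

variable {X Y : Type*} [AddCommGroup X] [Module ℂ X] [AddCommGroup Y] [Module ℂ Y]

/-- A sesquilinear form, linear in the first variable. -/
abbrev SesqForm (X : Type*) [AddCommGroup X] [Module ℂ X] : Type _ := X →ₗ[ℂ] X →ₗ⋆[ℂ] ℂ

/-- A form is Hermitian. -/
def SesqForm.IsHermitian (B : SesqForm X) : Prop := ∀ x y, conj (B x y) = B y x

/-- A finite family with Gram matrix `-1`. -/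
def SesqForm.IsNegSystem (B : SesqForm X) {m : ℕ} (e : Fin m → X) : Prop :=
  ∀ i j, B (e i) (e j) = if i = j then -1 else 0

/-- All families with Gram matrix `-1` have at most `n` elements. -/
def SesqForm.NegBound (B : SesqForm X) (n : ℕ) : Prop :=
  ∀ (m : ℕ) (e : Fin m → X), B.IsNegSystem e → m ≤ n

namespace SesqForm

variable {B : SesqForm X}

theorem IsHermitian.self_eq (hB : B.IsHermitian) (x : X) : B x x = ((B x x).re : ℂ) :=
  (Complex.conj_eq_iff_re.1 (hB x x)).symm

theorem IsHermitian.swap_eq_zero (hB : B.IsHermitian) {x y : X} (h : B x y = 0) : B y x = 0 := by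
  rw [← hB, h, map_zero]

theorem IsNegSystem.map {m : ℕ} {A : SesqForm Y} {e : Fin m → X} (he : B.IsNegSystem e)
    {f : X → Y} (hf : ∀ x y, A (f x) (f y) = B x y) : A.IsNegSystem (f ∘ e) :=
  fun i j => by rw [Function.comp_apply, Function.comp_apply, hf, he]

theorem exists_maximal_negSystem {n : ℕ} (hn : B.NegBound n) :
    ∃ (m : ℕ) (e : Fin m → X), B.IsNegSystem e ∧ B.NegBound m := by
  let s : Set ℕ := {m | ∃ e : Fin m → X, B.IsNegSystem e}
  have hs : s.Nonempty := ⟨0, Fin.elim0, fun i => i.elim0⟩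
  have hb : BddAbove s := ⟨n, fun m ⟨e, he⟩ => hn m e he⟩
  obtain ⟨e, he⟩ := Nat.sSup_mem hs hb
  exact ⟨sSup s, e, he, fun m f hf => le_csSup hb ⟨f, hf⟩⟩

/-- If [z,z] were negative, a normalized z could be appended to the system, giving n + 1 vectors. -/
theorem re_self_nonneg_of_orthogonal (hB : B.IsHermitian) {n : ℕ} {e : Fin n → X}
    (he : B.IsNegSystem e) (hn : B.NegBound n) {z : X} (hz : ∀ i, B z (e i) = 0) :
    0 ≤ (B z z).re := by
  by_contra! h
  have hr : 0 < √(-(B z z).re) := Real.sqrt_pos.2 (by linarith)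
  have hr2 : √(-(B z z).re) ^ 2 = -(B z z).re := Real.sq_sqrt (by linarith)
  set r := √(-(B z z).re)
  have key : B.IsNegSystem (Fin.cons ((r : ℂ)⁻¹ • z) e : Fin (n + 1) → X) := by
    intro i j
    refine Fin.cases ?_ (fun i => ?_) i <;> refine Fin.cases ?_ (fun j => ?_) j
    · simp only [Fin.cons_zero, map_smul, map_smulₛₗ, LinearMap.smul_apply, if_true]
      rw [hB.self_eq, ← neg_neg (B z z).re, ← hr2]
      have : (r : ℂ) ≠ 0 := by exact_mod_cast hr.ne'
      simp only [map_inv₀, Complex.conj_ofReal, smul_eq_mul]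
      push_cast
      field_simp
    · simp [hz, Fin.succ_ne_zero, eq_comm]
    · simp [hB.swap_eq_zero (hz i), Fin.succ_ne_zero]
    · simpa using he i j
  exact absurd (hn _ _ key) (by simp)

/-- The projection along the span of a negative system. -/
noncomputable def posPart (B : SesqForm X) {n : ℕ} (e : Fin n → X) : X →ₗ[ℂ] X :=
  LinearMap.id + ∑ i, (B.flip (e i)).smulRight (e i)

theorem posPart_apply {n : ℕ} (e : Fin n → X) (x : X) :
    B.posPart e x = x + ∑ i, B x (e i) • e i := by
  simp [posPart]

theorem IsNegSystem.form_posPart {n : ℕ} {e : Fin n → X} (he : B.IsNegSystem e) (x : X)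
    (i : Fin n) : B (B.posPart e x) (e i) = 0 := by
  simp [posPart_apply, he _ i]

/-- The form `[x, y] + 2 ∑ [x, eᵢ] conj [y, eᵢ]`. -/
noncomputable def majorant (B : SesqForm X) {n : ℕ} (e : Fin n → X) : SesqForm X :=
  LinearMap.mk₂'ₛₗ (RingHom.id ℂ) (starRingEnd ℂ)
    (fun x y => B x y + 2 * ∑ i, B x (e i) * conj (B y (e i)))
    (by intros; simp [add_mul, Finset.sum_add_distrib]; ring)
    (by intros; simp [mul_assoc, ← Finset.mul_sum]; ring)
    (by intros; simp [mul_add, Finset.sum_add_distrib]; ring)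
    (by
      intro c x y
      simp only [map_smulₛₗ, LinearMap.smul_apply, RingHom.id_apply, smul_eq_mul, map_mul,
        mul_add, Finset.mul_sum]
      congr 1
      exact Finset.sum_congr rfl fun i _ => by ring)

theorem majorant_apply {n : ℕ} (e : Fin n → X) (x y : X) :
    B.majorant e x y = B x y + 2 * ∑ i, B x (e i) * conj (B y (e i)) := rfl

theorem IsHermitian.majorant (hB : B.IsHermitian) {n : ℕ} (e : Fin n → X) :
    (B.majorant e).IsHermitian := fun x y => by
  simp [majorant_apply, hB x y, mul_comm, Complex.conj_ofNat]

theorem IsNegSystem.form_posPart_self (hB : B.IsHermitian) {n : ℕ} {e : Fin n → X}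
    (he : B.IsNegSystem e) (x : X) :
    B (B.posPart e x) (B.posPart e x) = B x x + ∑ i, B x (e i) * conj (B x (e i)) := by
  have h : B (B.posPart e x) (B.posPart e x) = B (B.posPart e x) x := by
    nth_rewrite 2 [posPart_apply]
    simp [he.form_posPart]
  rw [h, posPart_apply]
  simp [hB _ _]

theorem re_majorant_self_eq (hB : B.IsHermitian) {n : ℕ} {e : Fin n → X} (he : B.IsNegSystem e)
    (x : X) : (B.majorant e x x).re =
      (B (B.posPart e x) (B.posPart e x)).re + ∑ i, ‖B x (e i)‖ ^ 2 := by
  rw [he.form_posPart_self hB, majorant_apply]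
  simp only [Complex.mul_conj, Complex.add_re, Complex.mul_re, Complex.re_ofNat, Complex.im_ofNat,
    Complex.re_sum, Complex.ofReal_re, Complex.normSq_eq_norm_sq]
  ring

/-- Maximality makes the form nonnegative on the complement of the system, and the majorant flips
the sign on its span. This is the semi-inner product that gets completed later. -/
theorem re_majorant_self_nonneg (hB : B.IsHermitian) {n : ℕ} {e : Fin n → X}
    (he : B.IsNegSystem e) (hn : B.NegBound n) (x : X) : 0 ≤ (B.majorant e x x).re := by
  rw [re_majorant_self_eq hB he]
  have := re_self_nonneg_of_orthogonal hB he hn (he.form_posPart x)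
  positivity

/-- The reflection along the span of a negative system. -/
noncomputable def reflect (B : SesqForm X) {n : ℕ} (e : Fin n → X) : X →ₗ[ℂ] X :=
  LinearMap.id + (2 : ℂ) • ∑ i, (B.flip (e i)).smulRight (e i)

theorem reflect_apply {n : ℕ} (e : Fin n → X) (x : X) :
    B.reflect e x = x + (2 : ℂ) • ∑ i, B x (e i) • e i := by
  simp [reflect]

theorem IsHermitian.form_reflect (hB : B.IsHermitian) {n : ℕ} (e : Fin n → X) (x y : X) :
    B (B.reflect e x) y = B.majorant e x y := by
  simp [reflect_apply, majorant_apply, hB _ _]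

theorem IsNegSystem.reflect_reflect {n : ℕ} {e : Fin n → X} (he : B.IsNegSystem e) (x : X) :
    B.reflect e (B.reflect e x) = x := by
  have h : ∀ i, B (B.reflect e x) (e i) = -B x (e i) := fun i => by
    simp [reflect_apply, he _ i]; ring
  rw [reflect_apply (x := B.reflect e x)]
  simp only [h]
  rw [reflect_apply]
  simp

/-- The reflection relates the form to its majorant as a fundamental symmetry relates it to a
Hilbert inner product. -/
theorem IsNegSystem.majorant_reflect (hB : B.IsHermitian) {n : ℕ} {e : Fin n → X}
    (he : B.IsNegSystem e) (x y : X) : B.majorant e (B.reflect e x) y = B x y := by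
  rw [← hB.form_reflect, he.reflect_reflect]

/-- A positive semidefinite Hermitian form as a semi-inner product. -/
noncomputable abbrev preInnerCore (hB : B.IsHermitian) (h : ∀ x, 0 ≤ (B x x).re) :
    PreInnerProductSpace.Core ℂ X where
  inner x y := B y x
  conj_inner_symm x y := hB x y
  re_inner_nonneg := h
  add_left x y z := map_add _ _ _
  smul_left x y c := by simp

/-- Cauchy–Schwarz, which needs no definiteness. -/
theorem IsHermitian.norm_sq_le (hB : B.IsHermitian) (h : ∀ x, 0 ≤ (B x x).re) (x y : X) :
    ‖B x y‖ ^ 2 ≤ (B x x).re * (B y y).re := by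
  have key := @InnerProductSpace.Core.inner_mul_inner_self_le ℂ X _ _ _ (preInnerCore hB h) y x
  change ‖B x y‖ * ‖B y x‖ ≤ (B y y).re * (B x x).re at key
  rw [← hB x y, RCLike.norm_conj] at key
  linarith

theorem IsNegSystem.sum_form {n : ℕ} {e : Fin n → X} (he : B.IsNegSystem e) (t : Fin n → ℂ) :
    B (∑ i, t i • e i) (∑ i, t i • e i) = -∑ i, t i * conj (t i) := by
  simp [he _ _, mul_comm]

end SesqForm

end NegativeSystems

/-! ### Negative eigenvalues of a Hermitian matrix -/

section Matrices

open Matrix SesqForm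

/-- The form `(x, y) ↦ y* M x`. -/
noncomputable def Matrix.sesqForm {N : ℕ} (M : Matrix (Fin N) (Fin N) ℂ) : SesqForm (Fin N → ℂ) :=
  LinearMap.mk₂'ₛₗ (RingHom.id ℂ) (starRingEnd ℂ) (fun x y => star y ⬝ᵥ M *ᵥ x)
    (by intros; simp [mulVec_add]) (by intros; simp [mulVec_smul])
    (by intros; simp) (by intros; simp)

theorem Matrix.sesqForm_apply {N : ℕ} (M : Matrix (Fin N) (Fin N) ℂ) (x y : Fin N → ℂ) :
    M.sesqForm x y = star y ⬝ᵥ M *ᵥ x := rfl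

variable {N : ℕ} {M : Matrix (Fin N) (Fin N) ℂ}

theorem Matrix.sesqForm_gram {X : Type*} [AddCommGroup X] [Module ℂ X] {B : SesqForm X}
    {x : Fin N → X} (hM : ∀ l k, M l k = B (x k) (x l)) (s t : Fin N → ℂ) :
    B (∑ k, s k • x k) (∑ k, t k • x k) = M.sesqForm s t := by
  simp only [map_sum, LinearMap.sum_apply, map_smulₛₗ, LinearMap.smul_apply, sesqForm_apply,
    dotProduct, mulVec, hM, Finset.mul_sum, smul_eq_mul]
  refine Finset.sum_congr rfl fun l _ => Finset.sum_congr rfl fun k _ => ?_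
  simp only [RingHom.id_apply, Pi.star_apply, starRingEnd_apply]
  ring

theorem Matrix.sesqForm_eigenvectorBasis (hM : M.IsHermitian) (i j : Fin N) :
    M.sesqForm (hM.eigenvectorBasis i) (hM.eigenvectorBasis j) =
      if i = j then (hM.eigenvalues i : ℂ) else 0 := by
  have h := orthonormal_iff_ite.1 hM.eigenvectorBasis.orthonormal j i
  rw [EuclideanSpace.inner_eq_star_dotProduct, dotProduct_comm] at h
  rw [sesqForm_apply, hM.mulVec_eigenvectorBasis, dotProduct_smul, h]
  simp [eq_comm]

theorem Matrix.sesqForm_sum_eigenvectorBasis (hM : M.IsHermitian) (t : Fin N → ℂ) :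
    M.sesqForm (∑ i, t i • ⇑(hM.eigenvectorBasis i)) (∑ i, t i • ⇑(hM.eigenvectorBasis i)) =
      ((∑ i, hM.eigenvalues i * ‖t i‖ ^ 2 : ℝ) : ℂ) := by
  simp only [map_sum, LinearMap.sum_apply, map_smulₛₗ, LinearMap.smul_apply,
    sesqForm_eigenvectorBasis hM]
  simp only [smul_eq_mul, mul_ite, mul_zero]
  push_cast
  refine Finset.sum_congr rfl fun i _ => ?_
  rw [Finset.sum_ite_eq']
  simp [← Complex.mul_conj']
  ring

/-- Take the eigenvectors of the negative eigenvalues λ, each divided by √(-λ). -/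
theorem exists_negSystem_sesqForm (hM : M.IsHermitian) :
    ∃ f : Fin (negEigenvalueCount hM) → Fin N → ℂ, M.sesqForm.IsNegSystem f := by
  classical
  let s := Finset.univ.filter fun i => hM.eigenvalues i < 0
  have hs : s.card = negEigenvalueCount hM := by
    unfold negEigenvalueCount; congr
  let σ := s.equivFinOfCardEq hs
  have hneg : ∀ i, hM.eigenvalues (σ.symm i) < 0 := fun i => by
    exact (Finset.mem_filter.1 (σ.symm i).2).2
  refine ⟨fun i => ((√(-hM.eigenvalues (σ.symm i)) : ℝ) : ℂ)⁻¹ •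
    ⇑(hM.eigenvectorBasis (σ.symm i)), fun i j => ?_⟩
  rw [map_smulₛₗ, map_smulₛₗ, LinearMap.smul_apply, sesqForm_eigenvectorBasis hM]
  by_cases h : i = j
  · subst h
    have h2 : √(-hM.eigenvalues (σ.symm i)) ^ 2 = -hM.eigenvalues (σ.symm i) :=
      Real.sq_sqrt (by linarith [hneg i])
    simp only [if_true, map_inv₀, Complex.conj_ofReal, smul_eq_mul, RingHom.id_apply]
    rw [← mul_assoc, ← mul_inv, ← Complex.ofReal_mul, ← sq, h2, ← Complex.ofReal_inv,
      ← Complex.ofReal_mul, inv_neg, neg_mul, inv_mul_cancel₀ (hneg i).ne]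
    simp
  · have : ((σ.symm i : Fin N)) ≠ σ.symm j := fun h' => h (σ.symm.injective (Subtype.ext h'))
    simp [h, this]

/-- On the span of a negative system, the coordinates along the negative eigenvectors determine the
vector: where they all vanish the form is nonnegative, while on the span it is -∑ |tᵢ|². -/
theorem negBound_sesqForm (hM : M.IsHermitian) :
    M.sesqForm.NegBound (negEigenvalueCount hM) := by
  classical
  intro m f hf
  let s := Finset.univ.filter fun i => hM.eigenvalues i < 0
  have hs : s.card = negEigenvalueCount hM := by
    unfold negEigenvalueCount; congr
  let e := hM.eigenvectorBasis
  let coord : (Fin N → ℂ) →ₗ[ℂ] (s → ℂ) :=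
    LinearMap.pi fun i => LinearMap.proj (R := ℂ) (i : Fin N) ∘ₗ
      (e.toBasis.equivFun.toLinearMap ∘ₗ (WithLp.linearEquiv 2 ℂ (Fin N → ℂ)).symm.toLinearMap)
  let g : (Fin m → ℂ) →ₗ[ℂ] (s → ℂ) := coord ∘ₗ Fintype.linearCombination ℂ f
  have hg : Function.Injective g := by
    rw [← LinearMap.ker_eq_bot, LinearMap.ker_eq_bot']
    intro t ht
    set x := ∑ i, t i • f i with hx
    let c : Fin N → ℂ := e.toBasis.equivFun (WithLp.toLp 2 x)
    have hxe : x = ∑ i, c i • ⇑(e i) := by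
      have h := e.toBasis.sum_equivFun (WithLp.toLp 2 x)
      have h2 := congrArg (WithLp.linearEquiv 2 ℂ (Fin N → ℂ)) h
      simp only [map_sum, map_smul] at h2
      simpa [c] using h2.symm
    have hc : ∀ i, hM.eigenvalues i < 0 → c i = 0 := fun i hi =>
      congrFun ht ⟨i, by simpa [s] using hi⟩
    have h1 : M.sesqForm x x = ((∑ i, hM.eigenvalues i * ‖c i‖ ^ 2 : ℝ) : ℂ) := by
      rw [hxe]; exact sesqForm_sum_eigenvectorBasis hM c
    have h2 : M.sesqForm x x = ((-∑ i, ‖t i‖ ^ 2 : ℝ) : ℂ) := by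
      rw [hf.sum_form]; push_cast; simp [Complex.mul_conj']
    rw [h1, Complex.ofReal_inj] at h2
    have h3 : 0 ≤ ∑ i, hM.eigenvalues i * ‖c i‖ ^ 2 := Finset.sum_nonneg fun i _ => by
      by_cases hi : hM.eigenvalues i < 0
      · simp [hc i hi]
      · have := not_lt.1 hi; positivity
    have h4 : ∑ i, ‖t i‖ ^ 2 = 0 :=
      le_antisymm (by linarith) (Finset.sum_nonneg fun i _ => by positivity)
    ext i
    simpa using (Finset.sum_eq_zero_iff_of_nonneg (fun i _ => by positivity)).1 h4 i
      (Finset.mem_univ i)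
  have := LinearMap.finrank_le_finrank_of_injective hg
  simpa [hs] using this

theorem negEigenvalueCount_le_of_gram {X : Type*} [AddCommGroup X] [Module ℂ X] {B : SesqForm X}
    {n : ℕ} (hn : B.NegBound n) (hM : M.IsHermitian) {x : Fin N → X}
    (hx : ∀ l k, M l k = B (x k) (x l)) : negEigenvalueCount hM ≤ n := by
  obtain ⟨f, hf⟩ := exists_negSystem_sesqForm hM
  exact hn _ _ (hf.map (f := fun t => ∑ k, t k • x k) fun s t => sesqForm_gram hx s t)

/-- A negative system involves only finitely many unit vectors, so its length is bounded by the
eigenvalue count of their Gram matrix. -/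
theorem negBound_finsupp {ι : Type*} {B : SesqForm (ι →₀ ℂ)} {n : ℕ}
    (h : ∀ (N : ℕ) (p : Fin N → ι) (M : Matrix (Fin N) (Fin N) ℂ) (hM : M.IsHermitian),
      (∀ l k, M l k = B (.single (p k) 1) (.single (p l) 1)) → negEigenvalueCount hM ≤ n)
    (hB : B.IsHermitian) : B.NegBound n := by
  classical
  intro m e he
  let s : Finset ι := Finset.univ.biUnion fun i => (e i).support
  let σ := s.equivFin
  let M : Matrix (Fin s.card) (Fin s.card) ℂ :=
    Matrix.of fun l k => B (.single (σ.symm k : ι) 1) (.single (σ.symm l : ι) 1)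
  have hM : M.IsHermitian := by
    ext l k
    exact hB _ _
  have hsum : ∀ i, ∑ k, e i (σ.symm k) • (Finsupp.single (σ.symm k : ι) (1 : ℂ)) = e i := by
    intro i
    rw [Equiv.sum_comp σ.symm fun k : s => e i k • (Finsupp.single (k : ι) (1 : ℂ)),
      Finset.sum_coe_sort s fun k => e i k • (Finsupp.single (k : ι) (1 : ℂ))]
    simp only [Finsupp.smul_single, smul_eq_mul, mul_one]
    exact ((e i).sum_of_support_subset
      (Finset.subset_biUnion_of_mem (fun i => (e i).support) (Finset.mem_univ i)) _
      (by simp)).symm.trans (Finsupp.sum_single _)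
  refine (negBound_sesqForm hM m (fun i k => e i (σ.symm k)) fun i j => ?_).trans
    (h _ (fun k => σ.symm k) M hM fun l k => rfl)
  rw [← sesqForm_gram (M := M) (B := B) (x := fun k => Finsupp.single (σ.symm k : ι) (1 : ℂ))
    (fun l k => rfl), hsum, hsum, he]

end Matrices

/-! ### Negative systems in Pontryagin spaces -/

namespace PontryaginSpace

open SesqForm

section Basic

variable {V : Type*} [NormedAddCommGroup V] [InnerProductSpace ℂ V] [CompleteSpace V]
  [PontryaginSpace V]

theorem isHermitian_form : SesqForm.IsHermitian (form (V := V)) := form_conj_symm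

/-- The projection onto V₋ along V₊ is injective on the span of a negative system, because the form
is nonnegative on V₊. -/
theorem negBound_form : SesqForm.NegBound (form (V := V)) (negIndex V) := by
  intro m e he
  let g : (Fin m → ℂ) →ₗ[ℂ] neg (V := V) :=
    (neg (V := V)).projectionOnto pos isCompl.symm ∘ₗ Fintype.linearCombination ℂ e
  have hg : Function.Injective g := by
    rw [← LinearMap.ker_eq_bot, LinearMap.ker_eq_bot']
    intro t ht
    have hx : ∑ i, t i • e i ∈ pos (V := V) :=
      (Submodule.projectionOnto_apply_eq_zero_iff isCompl.symm).1 ht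
    have h1 := form_self_pos hx
    rw [he.sum_form] at h1
    have h2 : -∑ i, ‖t i‖ ^ 2 = ‖∑ i, t i • e i‖ ^ 2 := by
      have : ((-∑ i, ‖t i‖ ^ 2 : ℝ) : ℂ) = ((‖∑ i, t i • e i‖ ^ 2 : ℝ) : ℂ) := by
        rw [← h1]; push_cast; simp [Complex.mul_conj']
      exact_mod_cast this
    have h4 : ∑ i, ‖t i‖ ^ 2 = 0 := le_antisymm
      (by linarith [sq_nonneg ‖∑ i, t i • e i‖]) (Finset.sum_nonneg fun i _ => by positivity)
    ext i
    simpa using (Finset.sum_eq_zero_iff_of_nonneg (fun i _ => by positivity)).1 h4 i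
      (Finset.mem_univ i)
  have := LinearMap.finrank_le_finrank_of_injective hg
  simpa [negIndex] using this

theorem norm_form_le (x y : V) : ‖form x y‖ ≤ ‖fundamentalSymmetry V‖ * ‖x‖ * ‖y‖ := by
  rw [form_eq_inner, mul_comm _ ‖y‖]
  exact (norm_inner_le_norm _ _).trans
    (mul_le_mul_of_nonneg_left (ContinuousLinearMap.le_opNorm _ _) (norm_nonneg _))

theorem _root_.Continuous.pontryaginForm {Z : Type*} [TopologicalSpace Z] {f g : Z → V}
    (hf : Continuous f) (hg : Continuous g) : Continuous fun z => form (f z) (g z) := by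
  simp only [form_eq_inner]
  exact hg.inner ((fundamentalSymmetry V).continuous.comp hf)

theorem norm_reflect_le {n : ℕ} (e : Fin n → V) :
    ∃ C, 0 ≤ C ∧ ∀ x, ‖SesqForm.reflect (form (V := V)) e x‖ ≤ C * ‖x‖ := by
  refine ⟨1 + 2 * ∑ i, ‖fundamentalSymmetry V‖ * ‖e i‖ * ‖e i‖, by positivity, fun x => ?_⟩
  rw [reflect_apply, add_mul, one_mul, mul_assoc, Finset.sum_mul]
  refine (norm_add_le _ _).trans (add_le_add le_rfl ?_)
  rw [norm_smul, Complex.norm_ofNat]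
  refine mul_le_mul_of_nonneg_left ((norm_sum_le _ _).trans (Finset.sum_le_sum fun i _ => ?_))
    (by norm_num)
  rw [norm_smul]
  calc _ ≤ ‖fundamentalSymmetry V‖ * ‖x‖ * ‖e i‖ * ‖e i‖ :=
        mul_le_mul_of_nonneg_right (norm_form_le _ _) (norm_nonneg _)
    _ = _ := by ring

theorem re_majorant_le {n : ℕ} (e : Fin n → V) :
    ∃ C, 0 ≤ C ∧ ∀ x, (SesqForm.majorant (form (V := V)) e x x).re ≤ C * ‖x‖ ^ 2 := by
  obtain ⟨C, hC, h⟩ := norm_reflect_le e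
  refine ⟨‖fundamentalSymmetry V‖ * C, by positivity, fun x => ?_⟩
  rw [← isHermitian_form.form_reflect]
  refine (Complex.re_le_norm _).trans ((norm_form_le _ _).trans ?_)
  calc _ ≤ ‖fundamentalSymmetry V‖ * (C * ‖x‖) * ‖x‖ := by gcongr; exact h x
    _ = _ := by ring

/-- With `re_majorant_le`, the majorant of any maximal negative system is equivalent to the squared
Hilbert norm. This turns isometry into boundedness. -/
theorem norm_sq_le_majorant {n : ℕ} {e : Fin n → V} (he : SesqForm.IsNegSystem (form (V := V)) e)
    (hn : SesqForm.NegBound (form (V := V)) n) :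
    ∃ C, 0 ≤ C ∧ ∀ x, ‖x‖ ^ 2 ≤ C * (SesqForm.majorant (form (V := V)) e x x).re := by
  obtain ⟨C₁, hC₁, h₁⟩ := norm_reflect_le e
  obtain ⟨C₂, hC₂, h₂⟩ := re_majorant_le e
  refine ⟨C₂ * (C₁ * ‖fundamentalSymmetry V‖) ^ 2, by positivity, fun x => ?_⟩
  have hpos := re_majorant_self_nonneg isHermitian_form he hn
  -- This z is chosen so that its majorant pairing with x is [Jx, x] = ‖x‖². Cauchy–Schwarz then
  -- bounds ‖x‖⁴ by the product of the majorants of z and x, and that of z is at most a constant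
  -- times ‖x‖².
  set z := SesqForm.reflect (form (V := V)) e (fundamentalSymmetry V x) with hz
  have h3 : SesqForm.majorant (form (V := V)) e z x = ((‖x‖ ^ 2 : ℝ) : ℂ) := by
    rw [hz, he.majorant_reflect isHermitian_form, form_eq_inner, fundamentalSymmetry_apply_apply,
      inner_self_eq_norm_sq_to_K]
    push_cast; rfl
  have h4 := (isHermitian_form.majorant e).norm_sq_le hpos z x
  rw [h3, Complex.norm_real, Real.norm_of_nonneg (by positivity)] at h4
  have h5 : ‖z‖ ≤ C₁ * ‖fundamentalSymmetry V‖ * ‖x‖ := (h₁ _).trans (by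
    rw [mul_assoc]; exact mul_le_mul_of_nonneg_left (ContinuousLinearMap.le_opNorm _ _) hC₁)
  have h6 : (SesqForm.majorant (form (V := V)) e z z).re ≤
      C₂ * (C₁ * ‖fundamentalSymmetry V‖) ^ 2 * ‖x‖ ^ 2 := (h₂ z).trans (by
    rw [mul_assoc, ← mul_pow]; gcongr)
  rcases (norm_nonneg x).eq_or_lt with h0 | h0
  · rw [← h0, zero_pow two_ne_zero]
    exact mul_nonneg (by positivity) (hpos x)
  · have h7 : 0 < ‖x‖ ^ 2 := by positivity
    have h8 := h4.trans (mul_le_mul_of_nonneg_right h6 (hpos x))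
    nlinarith

end Basic

/-- The Pontryagin space obtained from a Hilbert space by changing the sign of the inner product
on a finite-dimensional subspace. -/
noncomputable abbrev ofSubmodule {V : Type*} [NormedAddCommGroup V] [InnerProductSpace ℂ V]
    [CompleteSpace V] (W : Submodule ℂ V) [FiniteDimensional ℂ W] : PontryaginSpace V where
  form := (hilbertForm (V := V)).comp
    (LinearMap.id - (2 : ℂ) • (W.starProjection : V →ₗ[ℂ] V))
  form_conj_symm x y := by
    simp [hilbertForm_apply, Complex.conj_ofNat]
    rw [← W.inner_starProjection_left_eq_right]
  pos := Wᗮ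
  neg := W
  isCompl := W.isCompl_orthogonal.symm
  form_pos_neg x hx y hy := by
    have h := (Submodule.starProjection_apply_eq_zero_iff W).2 hx
    simp [hilbertForm_apply, h, (Submodule.mem_orthogonal W x).1 hx y hy]
  norm_sq x hx y hy := by
    have h := (Submodule.starProjection_apply_eq_zero_iff W).2 hx
    have h' := Submodule.starProjection_eq_self_iff.2 hy
    have h0 := (Submodule.mem_orthogonal W x).1 hx y hy
    have h1 : inner ℂ x y = 0 := by rw [← inner_conj_symm, h0, map_zero]
    rw [← hilbertForm_self]
    simp [hilbertForm_apply, h, h', h0, h1]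
    ring
  finiteDimensional_neg := inferInstance

theorem ofSubmodule_form {V : Type*} [NormedAddCommGroup V] [InnerProductSpace ℂ V]
    [CompleteSpace V] (W : Submodule ℂ V) [FiniteDimensional ℂ W] (x y : V) :
    (ofSubmodule W).form x y = inner ℂ y (x - (2 : ℂ) • W.starProjection x) := rfl

/-- A Hermitian form with a maximal negative system is induced from a Pontryagin space. -/
theorem exists_completion {X : Type u} [AddCommGroup X] [Module ℂ X] {B : SesqForm X}
    (hB : B.IsHermitian) {n : ℕ} {e : Fin n → X} (he : B.IsNegSystem e) (hn : B.NegBound n) :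
    ∃ (P : Type u) (_ : NormedAddCommGroup P) (_ : InnerProductSpace ℂ P) (_ : CompleteSpace P)
      (_ : PontryaginSpace P) (q : X →ₗ[ℂ] P), negIndex P = n ∧ DenseRange q ∧
      (∀ x y, form (q x) (q y) = B x y) ∧ ∀ x, ‖q x‖ ^ 2 = (B.majorant e x x).re := by
  let c : PreInnerProductSpace.Core ℂ X :=
    preInnerCore (hB.majorant e) (re_majorant_self_nonneg hB he hn)
  let _ : SeminormedAddCommGroup X := InnerProductSpace.Core.toSeminormedAddCommGroup (c := c)
  let _ : InnerProductSpace ℂ X := InnerProductSpace.ofCore c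
  let q : X →ₗ[ℂ] UniformSpace.Completion X :=
    (UniformSpace.Completion.toComplL (𝕜 := ℂ) (E := X)).toLinearMap
  have hq : ∀ x y : X, inner ℂ (q x) (q y) = B.majorant e y x := fun x y =>
    UniformSpace.Completion.inner_coe x y
  have hRe : ∀ x i, B.majorant e x (e i) = -B x (e i) := fun x i => by
    simp [majorant_apply, he _ _, apply_ite]; ring
  have ho : Orthonormal ℂ (q ∘ e) := by
    rw [orthonormal_iff_ite]
    intro i j
    rw [Function.comp_apply, Function.comp_apply, hq, hRe, he]
    simp [eq_comm, apply_ite]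
  -- W becomes the negative part. The images of the eᵢ are orthonormal for the majorant, so the
  -- Hilbert reflection in W restricts to `reflect` and the form of `ofSubmodule` pulls back to B.
  let W := Submodule.span ℂ (Set.range (q ∘ e))
  have : FiniteDimensional ℂ W := FiniteDimensional.span_of_finite ℂ (Set.finite_range _)
  have hP : ∀ x, W.starProjection (q x) = q (-∑ i, B x (e i) • e i) := fun x => by
    refine Submodule.eq_starProjection_of_mem_orthogonal ?_ ?_
    · simp only [map_neg, map_sum, map_smul]
      exact neg_mem (sum_mem fun i _ =>
        Submodule.smul_mem _ _ (Submodule.subset_span ⟨i, rfl⟩))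
    · rw [← map_sub, sub_neg_eq_add, ← posPart_apply]
      refine (Submodule.mem_orthogonal _ _).2 fun y hy => ?_
      induction hy using Submodule.span_induction with
      | mem y hy =>
        obtain ⟨i, rfl⟩ := hy
        rw [Function.comp_apply, hq, hRe, he.form_posPart, neg_zero]
      | zero => simp
      | add y z _ _ hy hz => rw [inner_add_left, hy, hz, add_zero]
      | smul c y _ hy => rw [inner_smul_left, hy, mul_zero]
  refine ⟨UniformSpace.Completion X, inferInstance, inferInstance, inferInstance, ofSubmodule W, q,
    ?_, UniformSpace.Completion.denseRange_coe, fun x y => ?_, fun x => ?_⟩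
  · exact (finrank_span_eq_card ho.linearIndependent).trans (by simp)
  · rw [ofSubmodule_form, hP, ← map_smul, ← map_sub, hq, smul_neg, sub_neg_eq_add,
      ← reflect_apply, he.majorant_reflect hB]
  · rw [← hq]; exact norm_sq_eq_re_inner (𝕜 := ℂ) (q x)

end PontryaginSpace

/-! ### Isometric extension and perturbation of contractions -/

namespace PontryaginSpace

open SesqForm

section Extension

variable {K L : Type*}
  [NormedAddCommGroup K] [InnerProductSpace ℂ K] [CompleteSpace K] [PontryaginSpace K]
  [NormedAddCommGroup L] [InnerProductSpace ℂ L] [CompleteSpace L] [PontryaginSpace L]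
  {X : Type*} [AddCommGroup X] [Module ℂ X]

/-- The range of a linear map with dense range contains a maximal negative system. -/
theorem exists_negSystem_of_denseRange {u : X →ₗ[ℂ] K} (hu : DenseRange u) :
    ∃ e : Fin (negIndex K) → X, IsNegSystem (form (V := K)) (u ∘ e) := by
  let B : SesqForm X := LinearMap.mk₂'ₛₗ (RingHom.id ℂ) (starRingEnd ℂ)
    (fun x y => form (u x) (u y)) (by intros; simp) (by intros; simp) (by intros; simp)
    (by intros; simp)
  have hB : B.IsHermitian := fun x y => form_conj_symm _ _
  have hn : B.NegBound (negIndex K) := fun m e he => negBound_form m (u ∘ e) fun i j => he i j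
  obtain ⟨m, e, he, hm⟩ := exists_maximal_negSystem hn
  suffices m = negIndex K by subst this; exact ⟨e, fun i j => he i j⟩
  refine le_antisymm (hn m e he) (not_lt.1 fun hlt => ?_)
  -- With m < dim V₋ conditions, some nonzero z in V₋ is orthogonal to the whole system. By density
  -- and continuity its majorant is nonnegative, yet it equals [z,z] < 0.
  let G : neg (V := K) →ₗ[ℂ] (Fin m → ℂ) :=
    LinearMap.pi fun i => (form (V := K)).flip (u (e i)) ∘ₗ (neg (V := K)).subtype
  have hG : G.ker ≠ ⊥ := LinearMap.ker_ne_bot_of_finrank_lt (by simpa [negIndex] using hlt)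
  obtain ⟨z, hz, hz0⟩ := Submodule.exists_mem_ne_zero_of_ne_bot hG
  have hze : ∀ i, form (z : K) (u (e i)) = 0 := fun i => congrFun hz i
  have hcont : Continuous fun y : K => (majorant (form (V := K)) (u ∘ e) y y).re := by
    simp only [majorant_apply]
    refine Complex.continuous_re.comp (.add (continuous_id.pontryaginForm continuous_id)
      (continuous_const.mul (continuous_finsetSum _ fun i _ => ?_)))
    have := (continuous_id (X := K)).pontryaginForm (continuous_const (y := u (e i)))
    exact this.mul (Complex.continuous_conj.comp this)
  have hpos : 0 ≤ (majorant (form (V := K)) (u ∘ e) (z : K) z).re :=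
    hu.induction_on (p := fun y => 0 ≤ (majorant (form (V := K)) (u ∘ e) y y).re) (z : K)
      (isClosed_le continuous_const hcont) fun x => re_majorant_self_nonneg hB he hm x
  rw [majorant_apply, form_self_neg z.2] at hpos
  simp only [Function.comp_apply, hze, zero_mul, Finset.sum_const_zero, mul_zero, add_zero,
    Complex.neg_re, Complex.ofReal_re] at hpos
  have h0 : 0 < ‖(z : K)‖ := norm_pos_iff.2 fun h => hz0 (Subtype.ext h)
  nlinarith

/-- A densely defined isometric relation between Pontryagin spaces of the same index extends to
a continuous isometry. -/
theorem exists_isometric_extension (hKL : negIndex K = negIndex L) {u : X →ₗ[ℂ] K}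
    {v : X →ₗ[ℂ] L} (hu : DenseRange u) (h : ∀ x y, form (u x) (u y) = form (v x) (v y)) :
    ∃ A : K →L[ℂ] L, (∀ x, A (u x) = v x) ∧ ∀ x y, form (A x) (A y) = form x y := by
  obtain ⟨e, he⟩ := exists_negSystem_of_denseRange hu
  -- The transported system has `negIndex K = negIndex L` vectors, hence is maximal in L. The two
  -- majorants agree along u and v, which gives the bound on v.
  have he' : IsNegSystem (form (V := L)) (v ∘ e) := fun i j => by
    rw [Function.comp_apply, Function.comp_apply, ← h]; exact he i j
  obtain ⟨C₁, hC₁, h₁⟩ := norm_sq_le_majorant he' (hKL ▸ negBound_form)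
  obtain ⟨C₂, hC₂, h₂⟩ := re_majorant_le (u ∘ e)
  have hb : ∀ x, ‖v x‖ ≤ √(C₁ * C₂) * ‖u x‖ := fun x => by
    refine abs_le_of_sq_le_sq' ?_ (by positivity) |>.2
    rw [mul_pow, Real.sq_sqrt (by positivity), mul_assoc]
    refine (h₁ (v x)).trans (mul_le_mul_of_nonneg_left ((le_of_eq ?_).trans (h₂ (u x))) hC₁)
    simp only [majorant_apply, Function.comp_apply, h]
  have hA : ∀ x, v.extendOfNorm u (u x) = v x := v.extendOfNorm_eq hu ⟨_, hb⟩
  refine ⟨v.extendOfNorm u, hA, fun x y => ?_⟩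
  refine hu.induction_on₂ (p := fun x y => form (v.extendOfNorm u x) (v.extendOfNorm u y) =
    form x y) (isClosed_eq ?_ ?_) (fun x y => by rw [hA, hA, h]) x y
  · exact ((v.extendOfNorm u).continuous.comp continuous_fst).pontryaginForm
      ((v.extendOfNorm u).continuous.comp continuous_snd)
  · exact continuous_fst.pontryaginForm continuous_snd

end Extension

section Adjoint

variable {K L : Type*}
  [NormedAddCommGroup K] [InnerProductSpace ℂ K] [CompleteSpace K] [PontryaginSpace K]
  [NormedAddCommGroup L] [InnerProductSpace ℂ L] [CompleteSpace L] [PontryaginSpace L]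

theorem form_adj_left (A : K →L[ℂ] L) (x : L) (y : K) : form (adj A x) y = form x (A y) := by
  rw [← form_conj_symm, ← form_adj_right, form_conj_symm]

theorem adj_adj (A : K →L[ℂ] L) : adj (adj A) = A :=
  (adj_unique _ _ fun x y => form_adj_left A x y).symm

theorem adj_add (A B : K →L[ℂ] L) : adj (A + B) = adj A + adj B := by
  simp [adj, ContinuousLinearMap.add_comp, ContinuousLinearMap.comp_add]

theorem norm_fundamentalSymmetry_apply (x : K) : ‖fundamentalSymmetry K x‖ = ‖x‖ := by
  have h : inner ℂ (fundamentalSymmetry K x) (fundamentalSymmetry K x) = inner ℂ x x := by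
    rw [← form_eq_inner, ← form_conj_symm, form_eq_inner, fundamentalSymmetry_apply_apply,
      inner_conj_symm]
  rw [inner_self_eq_norm_sq_to_K, inner_self_eq_norm_sq_to_K] at h
  exact (sq_eq_sq₀ (norm_nonneg _) (norm_nonneg _)).1 (by exact_mod_cast h)

theorem norm_adj_le (A : K →L[ℂ] L) : ‖adj A‖ ≤ ‖A‖ := by
  refine ContinuousLinearMap.opNorm_le_bound _ (norm_nonneg _) fun x => ?_
  rw [adj, ContinuousLinearMap.comp_apply, ContinuousLinearMap.comp_apply,
    norm_fundamentalSymmetry_apply, ← norm_fundamentalSymmetry_apply x,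
    ← LinearIsometryEquiv.norm_map ContinuousLinearMap.adjoint A]
  exact ContinuousLinearMap.le_opNorm _ _

theorem form_self_of_starProjection_neg {x : K} (h : (neg (V := K)).starProjection x = 0) :
    form x x = ((‖x‖ ^ 2 : ℝ) : ℂ) := by
  rw [form_eq_inner, ← hilbertForm_self]
  simp [fundamentalSymmetry, h, hilbertForm_apply]

theorem isCompactOperator_starProjection {H : Type*} [NormedAddCommGroup H]
    [InnerProductSpace ℂ H] (W : Submodule ℂ H) [FiniteDimensional ℂ W] :
    IsCompactOperator W.starProjection :=
  have : ProperSpace W := FiniteDimensional.proper ℂ W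
  (isCompactOperator_of_locallyCompactSpace_dom W.orthogonalProjectionOnto).clm_comp W.subtypeL

/-- A compression of an isometry of Pontryagin spaces is the sum of a contraction and a compact
operator, so that the Fredholm alternative holds for it off the unit circle. -/
theorem isUnit_one_sub_smul_adj {A : K →L[ℂ] L} (hA : ∀ x y, form (A x) (A y) = form x y)
    {Q : L →L[ℂ] K} (hQ : ∀ y, ‖Q y‖ ≤ ‖y‖) {μ : ℂ} (hμ : ‖μ‖ < 1)
    (hinj : ∀ x, (1 - μ • adj (Q ∘L A)) x = 0 → x = 0) :
    IsUnit (1 - μ • adj (Q ∘L A)) := by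
  -- On the kernel N of Ψ both x and Ax have no negative component, so A preserves the Hilbert norm
  -- there. N has finite codimension because Ψ takes values in a finite-dimensional space.
  let Ψ : K →L[ℂ] (neg (V := K)) × (neg (V := L)) :=
    (neg (V := K)).orthogonalProjectionOnto.prod ((neg (V := L)).orthogonalProjectionOnto ∘L A)
  let N : Submodule ℂ K := Ψ.ker
  have hNc : IsClosed (N : Set K) := Ψ.isClosed_ker
  have : CompleteSpace N := hNc.completeSpace_coe
  have hNA : ∀ x ∈ N, ‖A x‖ = ‖x‖ := fun x hx => by
    have hx' : Ψ x = 0 := hx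
    have h1 : (neg (V := K)).starProjection x = 0 := congrArg (fun p => (p.1 : K)) hx'
    have h2 : (neg (V := L)).starProjection (A x) = 0 := congrArg (fun p => (p.2 : L)) hx'
    have h3 := hA x x
    rw [form_self_of_starProjection_neg h1, form_self_of_starProjection_neg h2,
      Complex.ofReal_inj] at h3
    exact (sq_eq_sq₀ (norm_nonneg _) (norm_nonneg _)).1 h3
  have : FiniteDimensional ℂ Nᗮ := by
    refine FiniteDimensional.of_injective (Ψ.toLinearMap ∘ₗ Nᗮ.subtype) ?_
    rw [← LinearMap.ker_eq_bot, LinearMap.ker_eq_bot']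
    intro x hx
    have : (x : K) ∈ N ⊓ Nᗮ := ⟨hx, x.2⟩
    rw [Submodule.inf_orthogonal_eq_bot] at this
    exact Subtype.ext this
  let W : K →L[ℂ] K := Q ∘L A ∘L N.starProjection
  let R : K →L[ℂ] K := Q ∘L A ∘L Nᗮ.starProjection
  have hWR : Q ∘L A = W + R := by
    ext x
    simp only [W, R, ContinuousLinearMap.comp_apply, _root_.add_apply]
    rw [← map_add, ← map_add, Submodule.starProjection_add_starProjection_orthogonal]
  have hW : ‖W‖ ≤ 1 := by
    refine ContinuousLinearMap.opNorm_le_bound _ zero_le_one fun x => ?_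
    rw [one_mul]
    exact ((hQ _).trans (hNA _ (Submodule.starProjection_apply_mem _ _)).le).trans
      (Submodule.norm_starProjection_apply_le _ _)
  have hR : IsCompactOperator (adj R) := by
    have : adj R = fundamentalSymmetry K ∘L Nᗮ.starProjection ∘L
        ContinuousLinearMap.adjoint (Q ∘L A) ∘L fundamentalSymmetry K := by
      rw [adj, show R = (Q ∘L A) ∘L Nᗮ.starProjection from rfl, ContinuousLinearMap.adjoint_comp,
        (isSelfAdjoint_starProjection Nᗮ).adjoint_eq]
      rfl
    rw [this]
    exact ((isCompactOperator_starProjection Nᗮ).comp_clm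
      (ContinuousLinearMap.adjoint (Q ∘L A) ∘L fundamentalSymmetry K)).clm_comp
      (fundamentalSymmetry K)
  rw [hWR, adj_add] at hinj ⊢
  have hYn : ‖μ • adj W‖ < 1 := by
    rw [norm_smul]
    calc ‖μ‖ * ‖adj W‖ ≤ ‖μ‖ * 1 := by gcongr; exact (norm_adj_le W).trans hW
      _ < 1 := by linarith
  obtain ⟨Y, hY⟩ := isUnit_one_sub_of_norm_lt_one hYn
  -- Factoring out the Neumann-invertible 1 - μ W^* leaves 1 minus a compact operator, for which 1
  -- is an eigenvalue or a resolvent point.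
  let T : K →L[ℂ] K := (↑Y⁻¹ : K →L[ℂ] K) * (μ • adj R)
  have hT : IsCompactOperator T := (hR.smul μ).clm_comp (↑Y⁻¹ : K →L[ℂ] K)
  have hfac : 1 - μ • (adj W + adj R) = Y * (1 - T) := by
    rw [mul_sub, mul_one, Units.mul_inv_cancel_left, hY, smul_add, sub_sub]
  rw [hfac] at hinj ⊢
  refine Y.isUnit.mul ?_
  rcases hT.hasEigenvalue_or_mem_resolventSet one_ne_zero with h | h
  · obtain ⟨x, hx⟩ := h.exists_hasEigenvector
    refine absurd (hinj x ?_) hx.2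
    have : T x = x := by simpa using hx.apply_eq_smul
    simp [this]
  · simpa [spectrum.mem_resolventSet_iff] using h

end Adjoint

end PontryaginSpace

/-! ### Forms on finitely supported functions -/

namespace SesqForm

variable {ι : Type*}

theorem ext_finsupp {A B : SesqForm (ι →₀ ℂ)}
    (h : ∀ p q, A (.single p 1) (.single q 1) = B (.single p 1) (.single q 1)) (x y : ι →₀ ℂ) :
    A x y = B x y := by
  induction x using Finsupp.induction_linear with
  | zero => simp
  | add x x' hx hx' => simp [hx, hx']
  | single p s =>
    induction y using Finsupp.induction_linear with
    | zero => simp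
    | add y y' hy hy' => simp [hy, hy']
    | single q t =>
      rw [← Finsupp.smul_single_one p s, ← Finsupp.smul_single_one q t]
      simp only [map_smulₛₗ, LinearMap.smul_apply, h]

/-- The form with Gram matrix `k` on the unit vectors. -/
noncomputable def ofKernel (k : ι → ι → ℂ) : SesqForm (ι →₀ ℂ) :=
  LinearMap.mk₂'ₛₗ (RingHom.id ℂ) (starRingEnd ℂ)
    (fun x y => Finsupp.linearCombination ℂ
      (fun p => conj (Finsupp.linearCombination ℂ (fun q => conj (k p q)) y)) x)
    (by intros; simp) (by intros; simp)
    (fun x y y' => by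
      induction x using Finsupp.induction_linear with
      | zero => simp
      | add x x' hx hx' => simp only [map_add] at hx hx' ⊢; rw [hx, hx']; ring
      | single p s => simp [mul_add])
    (fun c x y => by
      induction x using Finsupp.induction_linear with
      | zero => simp
      | add x x' hx hx' => rw [map_add, hx, hx', map_add, smul_add]
      | single p s => simp [mul_left_comm])

@[simp]
theorem ofKernel_single (k : ι → ι → ℂ) (p q : ι) :
    ofKernel k (.single p 1) (.single q 1) = k p q := by
  simp [ofKernel]

theorem isHermitian_ofKernel {k : ι → ι → ℂ} (hk : ∀ p q, conj (k p q) = k q p) :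
    (ofKernel k).IsHermitian := fun x y => by
  let A : SesqForm (ι →₀ ℂ) := LinearMap.mk₂'ₛₗ (RingHom.id ℂ) (starRingEnd ℂ)
    (fun x y => conj (ofKernel k y x)) (by intros; simp) (by intros; simp) (by intros; simp)
    (by intros; simp)
  exact ext_finsupp (A := A) (fun p q => by simp [A, hk]) y x

end SesqForm

/-! ### The kernel of a function on the unit disk -/

section DiskKernel

variable {C D : Type*}
  [NormedAddCommGroup C] [InnerProductSpace ℂ C] [CompleteSpace C] [PontryaginSpace C]
  [NormedAddCommGroup D] [InnerProductSpace ℂ D] [CompleteSpace D] [PontryaginSpace D]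

/-- The kernel `(I - S(z) S(w)^*) / (1 - β(z) conj β(w))`. -/
noncomputable def diskKernel (β : ℂ → ℂ) (S : ℂ → D →L[ℂ] C) (z w : ℂ) : C →L[ℂ] C :=
  (1 - β z * conj (β w))⁻¹ • (ContinuousLinearMap.id ℂ C - S z ∘L adj (S w))

theorem form_diskKernel (β : ℂ → ℂ) (S : ℂ → D →L[ℂ] C) (z w : ℂ) (c d : C) :
    form (diskKernel β S z w c) d =
      (1 - β z * conj (β w))⁻¹ * (form c d - form (adj (S w) c) (adj (S z) d)) := by
  simp [diskKernel, form_adj_right]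

theorem conj_form_diskKernel (β : ℂ → ℂ) (S : ℂ → D →L[ℂ] C) (z w : ℂ) (c d : C) :
    conj (form (diskKernel β S z w c) d) = form (diskKernel β S w z d) c := by
  simp [form_diskKernel, form_conj_symm, mul_comm]

theorem diskKernel_eq_adj (β : ℂ → ℂ) (S : ℂ → D →L[ℂ] C) (z w : ℂ) :
    diskKernel β S z w = adj (diskKernel β S w z) :=
  adj_unique _ _ fun x y => by rw [← form_conj_symm _ x, conj_form_diskKernel]

theorem PontryaginSpace.eq_of_form_left_eq {x x' : C} (h : ∀ y, form x y = form x' y) :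
    x = x' :=
  eq_of_form_eq fun y => by rw [← form_conj_symm, h, form_conj_symm]

theorem ContinuousOn.adj_apply {S : ℂ → D →L[ℂ] C} {U : Set ℂ} (hS : ContinuousOn S U) (c : C) :
    Continuous fun w : U => adj (S w) c := by
  have h1 : Continuous fun w : U => ContinuousLinearMap.adjoint (S w) :=
    ContinuousLinearMap.adjoint.continuous.comp hS.domRestrict
  exact (fundamentalSymmetry D).continuous.comp (h1.clm_apply continuous_const)

/-! ### The coisometric realization of a kernel -/

theorem one_sub_mul_conj_ne_zero {x y : ℂ} (hx : ‖x‖ < 1) (hy : ‖y‖ < 1) :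
    1 - x * conj y ≠ 0 := fun h => by
  have h1 : ‖x * conj y‖ = 1 := by rw [← sub_eq_zero.1 h, norm_one]
  rw [norm_mul, RCLike.norm_conj] at h1
  nlinarith [norm_nonneg x, norm_nonneg y]

/-- The space generated by the kernel: `k w c` represents the evaluation `f ↦ [f(w), c]`. -/
theorem exists_kernelSpace {C : Type u} {D : Type v}
    [NormedAddCommGroup C] [InnerProductSpace ℂ C] [CompleteSpace C] [PontryaginSpace C]
    [NormedAddCommGroup D] [InnerProductSpace ℂ D] [CompleteSpace D] [PontryaginSpace D]
    {U : Set ℂ} {β : ℂ → ℂ} (hβ : ContinuousOn β U) (hβ1 : ∀ z ∈ U, ‖β z‖ < 1)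
    {S : ℂ → D →L[ℂ] C} (hS : ContinuousOn S U) {κ : ℕ}
    (hK : HasNegativeSquares (diskKernel β S) U κ) :
    ∃ (P : Type (max u w)) (_ : NormedAddCommGroup P) (_ : InnerProductSpace ℂ P)
      (_ : CompleteSpace P) (_ : PontryaginSpace P) (k : U → C → P), negIndex P = κ ∧
      (∀ (w : U) c (z : U) d, form (k w c) (k z d) = form (diskKernel β S z w c) d) ∧
      (∀ c, Continuous fun w => k w c) ∧
      (Submodule.span ℂ (Set.range fun p : U × C => k p.1 p.2)).topologicalClosure = ⊤ := by
  -- The lift puts the state space in the universe of the final statement.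
  let ι : Type (max u w) := ULift.{w} (U × C)
  let k₀ : ι → ι → ℂ := fun p q => form (diskKernel β S q.down.1 p.down.1 p.down.2) q.down.2
  let B := SesqForm.ofKernel k₀
  have hB : B.IsHermitian := SesqForm.isHermitian_ofKernel fun p q => conj_form_diskKernel _ _ _ _ _ _
  have hn : B.NegBound κ := by
    refine negBound_finsupp (fun N p M hM hMk => ?_) hB
    have : M = kernelMatrix (diskKernel β S) (fun i => ((p i).down.1 : ℂ)) fun i => (p i).down.2 := by
      ext l k
      rw [hMk, SesqForm.ofKernel_single]; rfl
    subst this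
    exact hK.count_le N _ (fun i => (p i).down.1.2) _
  obtain ⟨e, he⟩ : ∃ e : Fin κ → ι →₀ ℂ, B.IsNegSystem e := by
    obtain ⟨N, w, hw, c, hc⟩ := hK.exists_count_eq
    obtain ⟨f, hf⟩ := exists_negSystem_sesqForm (kernelMatrix_isHermitian hK.hermitian hw c)
    rw [← hc]
    refine ⟨fun i => ∑ l, f i l • Finsupp.single (ULift.up (⟨w l, hw l⟩, c l)) 1, fun i j => ?_⟩
    rw [Matrix.sesqForm_gram (M := kernelMatrix (diskKernel β S) w c), hf]
    intro l m
    rw [SesqForm.ofKernel_single]; rfl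
  obtain ⟨P, i1, i2, i3, i4, q, hP, hq, hqf, hqn⟩ := exists_completion hB he hn
  let s : U → C → ι →₀ ℂ := fun w c => Finsupp.single (ULift.up (w, c)) 1
  have hs : ∀ w c z d, B (s w c) (s z d) = form (diskKernel β S z w c) d := fun w c z d => by
    simp [B, s, k₀]
  -- Taking f and g among the identity and constants covers the diagonal and both partial maps of
  -- the kernel.
  have hcont : ∀ (c d : C) (f g : U → U), Continuous f → Continuous g →
      Continuous fun w => B (s (f w) c) (s (g w) d) := fun c d f g hf hg => by
    simp only [hs, form_diskKernel]
    have hβ' : Continuous fun w : U => β w := hβ.domRestrict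
    refine ((continuous_const.sub ((hβ'.comp hg).mul
      (Complex.continuous_conj.comp (hβ'.comp hf)))).inv₀ fun w => ?_).mul
      (continuous_const.sub (((hS.adj_apply c).comp hf).pontryaginForm
        ((hS.adj_apply d).comp hg)))
    exact one_sub_mul_conj_ne_zero (hβ1 _ (g w).2) (hβ1 _ (f w).2)
  have hcont' : ∀ c y, Continuous fun w => B (s w c) y := fun c y => by
    induction y using Finsupp.induction_linear with
    | zero => simpa using continuous_const
    | add y y' hy hy' => simp only [map_add]; exact hy.add hy'
    | single p t =>
      have : (Finsupp.single p t : ι →₀ ℂ) = t • s p.down.1 p.down.2 :=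
        (Finsupp.smul_single_one p t).symm
      rw [this]
      simp only [map_smulₛₗ]
      exact (hcont c _ id (fun _ => p.down.1) continuous_id continuous_const).const_smul (conj t)
  refine ⟨P, i1, i2, i3, i4, fun w c => q (s w c), hP, fun w c z d => by rw [hqf, hs],
    fun c => ?_, ?_⟩
  · refine continuous_iff_continuousAt.2 fun v => ?_
    -- Norm continuity of the generators: this squared distance is a majorant, hence a polynomial in
    -- continuous kernel values and their conjugates.
    have h1 : Continuous fun w => ‖q (s w c) - q (s v c)‖ ^ 2 := by
      simp only [← map_sub, hqn, SesqForm.majorant_apply]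
      simp only [map_sub, LinearMap.sub_apply]
      refine Complex.continuous_re.comp (.add (.sub (.sub ?_ ?_) (.sub ?_ ?_))
        (continuous_const.mul (continuous_finsetSum _ fun i _ => ?_)))
      · exact hcont _ _ _ _ continuous_id continuous_id
      · exact hcont _ _ _ _ continuous_const continuous_id
      · exact hcont _ _ _ _ continuous_id continuous_const
      · exact continuous_const
      · have h : Continuous fun w => B (s w c) (e i) - B (s v c) (e i) :=
          (hcont' c (e i)).sub continuous_const
        exact (h.mul (Complex.continuous_conj.comp h)).congr fun w => by simp
    have h2 := h1.sqrt.tendsto v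
    simp only [Real.sqrt_sq (norm_nonneg _), sub_self, norm_zero, zero_pow two_ne_zero,
      Real.sqrt_zero] at h2
    exact tendsto_iff_norm_sub_tendsto_zero.2 h2
  · refine SetLike.coe_injective (Set.eq_univ_of_univ_subset ?_)
    rw [← hq.closure_range]
    refine closure_mono ?_
    rintro _ ⟨x, rfl⟩
    induction x using Finsupp.induction_linear with
    | zero => simp
    | add x y hx hy => rw [map_add]; exact add_mem hx hy
    | single p t =>
      have : (Finsupp.single p t : ι →₀ ℂ) = t • s p.down.1 p.down.2 :=
        (Finsupp.smul_single_one p t).symm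
      rw [this, map_smul]
      exact Submodule.smul_mem _ _ (Submodule.subset_span ⟨p.down, rfl⟩)

end DiskKernel

/-! ### Direct sums and operator matrices -/

section Colligations

variable {P C D : Type*}
  [NormedAddCommGroup P] [InnerProductSpace ℂ P] [CompleteSpace P] [PontryaginSpace P]
  [NormedAddCommGroup C] [InnerProductSpace ℂ C] [CompleteSpace C] [PontryaginSpace C]
  [NormedAddCommGroup D] [InnerProductSpace ℂ D] [CompleteSpace D] [PontryaginSpace D]

theorem PontryaginSpace.form_prod (x y : WithLp 2 (P × C)) :
    form x y = form x.fst y.fst + form x.snd y.snd := rfl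

theorem PontryaginSpace.form_toLp (x x' : P) (y y' : C) :
    form (WithLp.toLp 2 (x, y)) (WithLp.toLp 2 (x', y')) = form x x' + form y y' := rfl

theorem PontryaginSpace.negIndex_prod :
    negIndex (WithLp 2 (P × C)) = negIndex P + negIndex C := by
  have h := ((WithLp.linearEquiv 2 ℂ (P × C)).ofSubmodule'
    ((neg (V := P)).prod (neg (V := C)))).finrank_eq
  let g : (neg (V := P)).prod (neg (V := C)) ≃ₗ[ℂ] neg (V := P) × neg (V := C) :=
    { toFun x := (⟨x.1.1, x.2.1⟩, ⟨x.1.2, x.2.2⟩)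
      map_add' _ _ := rfl
      map_smul' _ _ := rfl
      invFun y := ⟨(y.1, y.2), y.1.2, y.2.2⟩
      left_inv _ := rfl
      right_inv _ := rfl }
  exact h.trans (g.finrank_eq.trans Module.finrank_prod)

/-- The adjoint of an isometry is a coisometry. -/
theorem PontryaginSpace.isCoisometry_adj {A : P →L[ℂ] C}
    (hA : ∀ x y, form (A x) (A y) = form x y) : IsCoisometry (adj A) := by
  ext x
  refine eq_of_form_eq fun y => ?_
  rw [adj_adj, ContinuousLinearMap.comp_apply, ← form_adj_right, hA]
  rfl

/-- The adjoint of a coisometry is an isometry. -/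
theorem PontryaginSpace.IsCoisometry.form_adj {A : P →L[ℂ] C} (hA : IsCoisometry A) (x y : C) :
    form (adj A x) (adj A y) = form x y := by
  rw [← form_adj_right, ← ContinuousLinearMap.comp_apply, hA]
  rfl

/-- The entries are the adjoints of the blocks of A. The formula for T is kept because the Fredholm
argument needs T as the adjoint of a compression. -/
theorem exists_colligation (A : WithLp 2 (P × C) →L[ℂ] WithLp 2 (P × D)) :
    ∃ (T : P →L[ℂ] P) (F : D →L[ℂ] P) (G : P →L[ℂ] C) (H : D →L[ℂ] C),
      colligation T F G H = adj A ∧ T = adj (WithLp.fstL 2 ℂ P D ∘L A ∘L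
        ((WithLp.prodContinuousLinearEquiv 2 ℂ P C).symm.toContinuousLinearMap ∘L
          ContinuousLinearMap.inl ℂ P C)) := by
  let i₁ := (WithLp.prodContinuousLinearEquiv 2 ℂ P C).symm.toContinuousLinearMap ∘L
    ContinuousLinearMap.inl ℂ P C
  let i₂ := (WithLp.prodContinuousLinearEquiv 2 ℂ P C).symm.toContinuousLinearMap ∘L
    ContinuousLinearMap.inr ℂ P C
  refine ⟨adj (WithLp.fstL 2 ℂ P D ∘L A ∘L i₁), adj (WithLp.sndL 2 ℂ P D ∘L A ∘L i₁),
    adj (WithLp.fstL 2 ℂ P D ∘L A ∘L i₂), adj (WithLp.sndL 2 ℂ P D ∘L A ∘L i₂),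
    adj_unique _ _ fun x y => ?_, rfl⟩
  have hx : A x = A (i₁ x.fst) + A (i₂ x.snd) := by
    rw [← map_add]
    congr 1
    apply WithLp.ofLp_injective
    ext <;> simp [i₁, i₂]
  obtain ⟨y₁, y₂⟩ := y
  change form (A x) _ = form x _
  rw [colligation_apply, form_prod, form_prod, hx]
  change form ((A (i₁ x.fst)).fst + (A (i₂ x.snd)).fst) y₁ +
    form ((A (i₁ x.fst)).snd + (A (i₂ x.snd)).snd) y₂ =
    form x.fst (adj (WithLp.fstL 2 ℂ P D ∘L A ∘L i₁) y₁ +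
      adj (WithLp.sndL 2 ℂ P D ∘L A ∘L i₁) y₂) +
    form x.snd (adj (WithLp.fstL 2 ℂ P D ∘L A ∘L i₂) y₁ +
      adj (WithLp.sndL 2 ℂ P D ∘L A ∘L i₂) y₂)
  simp only [map_add, LinearMap.add_apply, ← form_adj_right, ContinuousLinearMap.comp_apply,
    WithLp.fstL_apply, WithLp.sndL_apply]
  ring

end Colligations

/-! ### From the kernel to a coisometric realization -/

section Realization

/-- `S(z) = H + β(z) G (I - β(z) T)⁻¹ F` on `U` with a coisometric operator matrix acting on a
state space of index `κ`. -/
def HasDiskRealization {C : Type u} {D : Type v}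
    [NormedAddCommGroup C] [InnerProductSpace ℂ C] [CompleteSpace C] [PontryaginSpace C]
    [NormedAddCommGroup D] [InnerProductSpace ℂ D] [CompleteSpace D] [PontryaginSpace D]
    (β : ℂ → ℂ) (U : Set ℂ) (S : ℂ → D →L[ℂ] C) (κ : ℕ) : Prop :=
  ∃ (P : Type w) (_ : NormedAddCommGroup P) (_ : InnerProductSpace ℂ P) (_ : CompleteSpace P)
    (_ : PontryaginSpace P) (T : P →L[ℂ] P) (F : D →L[ℂ] P) (G : P →L[ℂ] C) (H : D →L[ℂ] C),
    negIndex P = κ ∧ IsCoisometry (colligation T F G H) ∧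
    ∀ z ∈ U, IsUnit (1 - β z • T) ∧ S z = H + β z • (G ∘L Ring.inverse (1 - β z • T) ∘L F)

variable {C : Type u} {D : Type v}
  [NormedAddCommGroup C] [InnerProductSpace ℂ C] [CompleteSpace C] [PontryaginSpace C]
  [NormedAddCommGroup D] [InnerProductSpace ℂ D] [CompleteSpace D] [PontryaginSpace D]
  {β : ℂ → ℂ} {U : Set ℂ} {S : ℂ → D →L[ℂ] C}

/-- The lurking isometry argument: u and v below are the two sides of the isometric relation encoded
by the kernel. -/
theorem hasDiskRealization_of_hasNegativeSquares (hCD : negIndex C = negIndex D)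
    (hβ : ContinuousOn β U) (hβ1 : ∀ z ∈ U, ‖β z‖ < 1)
    (hdense : ∀ w : U, Dense {z : U | β z ≠ β w}) {α : U} (hα : β α = 0)
    (hS : ContinuousOn S U) {κ : ℕ} (hK : HasNegativeSquares (diskKernel β S) U κ) :
    HasDiskRealization.{u, v, max u w} β U S κ := by
  obtain ⟨P, i1, i2, i3, i4, k, hP, hk, hkc, hks⟩ :=
    exists_kernelSpace.{u, v, w} hβ hβ1 hS hK
  let u : (U × C →₀ ℂ) →ₗ[ℂ] WithLp 2 (P × C) :=
    Finsupp.linearCombination ℂ fun p => WithLp.toLp 2 (conj (β p.1) • k p.1 p.2, p.2)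
  let v : (U × C →₀ ℂ) →ₗ[ℂ] WithLp 2 (P × D) :=
    Finsupp.linearCombination ℂ fun p => WithLp.toLp 2 (k p.1 p.2, adj (S p.1) p.2)
  have hu1 : ∀ w c, u (.single (w, c) 1) = WithLp.toLp 2 (conj (β w) • k w c, c) := by simp [u]
  have hv1 : ∀ w c, v (.single (w, c) 1) = WithLp.toLp 2 (k w c, adj (S w) c) := by simp [v]
  have huv : ∀ x y, form (u x) (u y) = form (v x) (v y) := by
    let A : SesqForm (U × C →₀ ℂ) := LinearMap.mk₂'ₛₗ (RingHom.id ℂ) (starRingEnd ℂ)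
      (fun x y => form (u x) (u y)) (by intros; simp) (by intros; simp) (by intros; simp)
      (by intros; simp)
    let B : SesqForm (U × C →₀ ℂ) := LinearMap.mk₂'ₛₗ (RingHom.id ℂ) (starRingEnd ℂ)
      (fun x y => form (v x) (v y)) (by intros; simp) (by intros; simp) (by intros; simp)
      (by intros; simp)
    refine SesqForm.ext_finsupp (A := A) (B := B) fun p q => ?_
    change form (u (.single (p.1, p.2) 1)) (u (.single (q.1, q.2) 1)) =
      form (v (.single (p.1, p.2) 1)) (v (.single (q.1, q.2) 1))
    rw [hu1, hu1, hv1, hv1, form_toLp, form_toLp]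
    simp only [map_smulₛₗ, LinearMap.smul_apply, hk, form_diskKernel, smul_eq_mul,
      RingHom.id_apply, Complex.conj_conj]
    have := one_sub_mul_conj_ne_zero (hβ1 _ q.1.2) (hβ1 _ p.1.2)
    field_simp
    ring
  -- Since β(α) = 0, the generators at α give 0 ⊕ C. Subtracting these gives k_w c wherever β(w) ≠
  -- 0, and continuity in w fills in the zeros of β.
  have hu : DenseRange u := by
    let Z := u.range.topologicalClosure
    have hZu : ∀ x, u x ∈ Z := fun x => u.range.le_topologicalClosure ⟨x, rfl⟩
    have hZ2 : ∀ c, WithLp.toLp 2 ((0 : P), c) ∈ Z := fun c => by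
      have := hZu (.single (α, c) 1)
      rwa [hu1, hα, map_zero, zero_smul] at this
    let j : P →L[ℂ] WithLp 2 (P × C) :=
      (WithLp.prodContinuousLinearEquiv 2 ℂ P C).symm.toContinuousLinearMap ∘L
        ContinuousLinearMap.inl ℂ P C
    have hj : ∀ x, j x = WithLp.toLp 2 (x, 0) := fun x => rfl
    have hZk : ∀ (w : U) c, β w ≠ 0 → j (k w c) ∈ Z := fun w c hw => by
      have hw' : conj (β w) ≠ 0 := by simpa using hw
      have := Z.smul_mem (conj (β w))⁻¹ (Z.sub_mem (hZu (.single (w, c) 1)) (hZ2 c))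
      rw [hu1] at this
      convert this using 1
      apply WithLp.ofLp_injective
      ext <;> simp [hj, hw']
    have hZclosed : IsClosed (Z : Set (WithLp 2 (P × C))) :=
      Submodule.isClosed_topologicalClosure _
    have hZk' : ∀ c w, j (k w c) ∈ Z := fun c => by
      have hcl : IsClosed {w : U | j (k w c) ∈ Z} :=
        hZclosed.preimage (j.continuous.comp (hkc c))
      have hd := hdense α
      rw [hα] at hd
      have hsub : {w : U | β w ≠ 0} ⊆ {w : U | j (k w c) ∈ Z} := fun w hw => hZk w c hw
      have := (hd.mono hsub).closure_eq
      rw [hcl.closure_eq] at this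
      exact fun w => (Set.eq_univ_iff_forall.1 this) w
    have hZ1 : ∀ x, j x ∈ Z := fun x => by
      have : (Submodule.span ℂ (Set.range fun p : U × C => k p.1 p.2)).topologicalClosure ≤
          Z.comap j.toLinearMap :=
        Submodule.topologicalClosure_minimal _
          (Submodule.span_le.2 (by rintro _ ⟨p, rfl⟩; exact hZk' p.2 p.1))
          (hZclosed.preimage j.continuous)
      rw [hks] at this
      exact this trivial
    intro x
    have hx : x = j x.fst + WithLp.toLp 2 (0, x.snd) := by
      apply WithLp.ofLp_injective
      ext <;> simp [hj]
    have : x ∈ Z := hx ▸ Z.add_mem (hZ1 _) (hZ2 _)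
    exact this
  have hidx : negIndex (WithLp 2 (P × C)) = negIndex (WithLp 2 (P × D)) := by
    rw [negIndex_prod, negIndex_prod, hCD]
  obtain ⟨A, hA, hAiso⟩ := exists_isometric_extension hidx hu huv
  obtain ⟨T, F, G, H, hM, hT⟩ := exists_colligation A
  -- The adjoint relation for A tested on one generator; both injectivity and the formula for S come
  -- from it.
  have key : ∀ (f : P) (d : D) (w : U) (c : C), form f (k w c) + form d (adj (S w) c) =
      β w * form (T f + F d) (k w c) + form (G f + H d) c := fun f d w c => by
    have h := form_adj_left A (WithLp.toLp 2 (f, d)) (u (.single (w, c) 1))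
    rw [hA, ← hM, colligation_apply, hu1, hv1, form_toLp, form_toLp] at h
    simp only [map_smulₛₗ, smul_eq_mul, Complex.conj_conj] at h
    exact h.symm
  have hinj : ∀ (w₀ : U) x, (1 - β w₀ • T) x = 0 → x = 0 := fun w₀ x hx => by
    have hx' : x = β w₀ • T x := by simpa [sub_eq_zero] using hx
    rcases eq_or_ne (β w₀) 0 with h0 | h0
    · rw [hx', h0, zero_smul]
    have hTx : T x = (β w₀)⁻¹ • x := by
      nth_rewrite 2 [hx']; rw [inv_smul_smul₀ h0]
    have hk1 : ∀ w c, form x (k w c) = β w * (β w₀)⁻¹ * form x (k w c) + form (G x) c :=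
      fun w c => by
        have := key x 0 w c
        simpa [hTx, mul_assoc] using this
    -- At w = w₀ the terms with k cancel. Then `hk1` forces [x, k_w c] = 0 wherever β(w) ≠ β(w₀),
    -- hence everywhere by density.
    have hG : ∀ c, form (G x) c = 0 := fun c => by
      have := hk1 w₀ c
      rwa [mul_inv_cancel₀ h0, one_mul, left_eq_add] at this
    have hk2 : ∀ c w, form x (k w c) = 0 := fun c => by
      have hcl : IsClosed {w : U | form x (k w c) = 0} :=
        isClosed_eq (continuous_const.pontryaginForm (hkc c)) continuous_const
      have hsub : {w : U | β w ≠ β w₀} ⊆ {w : U | form x (k w c) = 0} := fun w hw => by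
        have h := hk1 w c
        rw [hG, add_zero] at h
        by_contra h'
        have h1 : β w * (β w₀)⁻¹ = 1 := (mul_eq_right₀ h').1 h.symm
        exact hw ((mul_inv_eq_one₀ h0).1 h1)
      have := ((hdense w₀).mono hsub).closure_eq
      rw [hcl.closure_eq] at this
      exact fun w => (Set.eq_univ_iff_forall.1 this) w
    have hk3 : ∀ y, form x y = 0 := fun y => by
      have : (Submodule.span ℂ (Set.range fun p : U × C => k p.1 p.2)).topologicalClosure ≤
          (form x).ker :=
        Submodule.topologicalClosure_minimal _
          (Submodule.span_le.2 (by rintro _ ⟨p, rfl⟩; exact hk2 p.2 p.1))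
          (isClosed_eq (continuous_const.pontryaginForm continuous_id) continuous_const)
      rw [hks] at this
      exact this trivial
    exact eq_of_form_left_eq fun y => by rw [hk3]; simp
  refine ⟨P, i1, i2, i3, i4, T, F, G, H, hP, hM ▸ isCoisometry_adj hAiso, fun z hz => ?_⟩
  have hunit : IsUnit (1 - β z • T) := by
    have h := hinj ⟨z, hz⟩
    rw [hT] at h ⊢
    -- Here A restricted to P ⊕ 0 is the isometry, and the first-coordinate projection is the
    -- Hilbert contraction.
    refine isUnit_one_sub_smul_adj (fun x y => ?_) (fun y => ?_) (hβ1 z hz) h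
    · exact (hAiso _ _).trans (by rw [form_prod]; simp)
    · exact WithLp.norm_fst_le P y
  refine ⟨hunit, ContinuousLinearMap.ext fun d => eq_of_form_left_eq fun c => ?_⟩
  set R := Ring.inverse (1 - β z • T) with hR
  have hRF : R (F d) - β z • T (R (F d)) = F d := by
    have := congrArg (fun X : P →L[ℂ] P => X (F d)) (Ring.mul_inverse_cancel _ hunit)
    simpa using this
  -- `h1` gives [S(z)d, c] = β(z)[Fd, k_z c] + [Hd, c]. `h2` identifies [Fd, k_z c] with [G(I -
  -- β(z)T)⁻¹Fd, c].
  have h1 := key 0 d ⟨z, hz⟩ c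
  have h2 := key (R (F d)) 0 ⟨z, hz⟩ c
  simp only [map_zero, add_zero, zero_add, LinearMap.zero_apply] at h1 h2
  rw [form_adj_right, h1]
  have h3 : form (F d) (k ⟨z, hz⟩ c) = form (G (R (F d))) c := by
    nth_rewrite 1 [← hRF]
    rw [map_sub, LinearMap.sub_apply, h2]
    simp
  rw [h3]
  simp [add_comm]

end Realization

/-! ### From a realization back to the kernel -/

theorem differentiableOn_realization {P C D : Type*}
    [NormedAddCommGroup P] [InnerProductSpace ℂ P] [CompleteSpace P]
    [NormedAddCommGroup C] [InnerProductSpace ℂ C] [NormedAddCommGroup D] [InnerProductSpace ℂ D]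
    {β : ℂ → ℂ} {U : Set ℂ} {T : P →L[ℂ] P} (F : D →L[ℂ] P) (G : P →L[ℂ] C) (H : D →L[ℂ] C)
    (hβ : DifferentiableOn ℂ β U) (h : ∀ z ∈ U, IsUnit (1 - β z • T)) :
    DifferentiableOn ℂ (fun z => H + β z • (G ∘L Ring.inverse (1 - β z • T) ∘L F)) U := by
  have h1 : DifferentiableOn ℂ (fun z => Ring.inverse (1 - β z • T)) U :=
    ((differentiableOn_const _).sub (hβ.smul_const T)).inverse h
  exact (differentiableOn_const _).add
    (hβ.smul ((differentiableOn_const _).clm_comp (h1.clm_comp (differentiableOn_const _))))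

section Realization

variable {C : Type u} {D : Type v}
  [NormedAddCommGroup C] [InnerProductSpace ℂ C] [CompleteSpace C] [PontryaginSpace C]
  [NormedAddCommGroup D] [InnerProductSpace ℂ D] [CompleteSpace D] [PontryaginSpace D]
  {β : ℂ → ℂ} {U : Set ℂ} {S : ℂ → D →L[ℂ] C}

/-- The kernel of a coisometric realization is a Gram kernel. -/
theorem form_diskKernel_eq_of_realization {P : Type*}
    [NormedAddCommGroup P] [InnerProductSpace ℂ P] [CompleteSpace P] [PontryaginSpace P]
    {T : P →L[ℂ] P} {F : D →L[ℂ] P} {G : P →L[ℂ] C} {H : D →L[ℂ] C}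
    (hM : IsCoisometry (colligation T F G H)) (hβ1 : ∀ z ∈ U, ‖β z‖ < 1)
    (h : ∀ z ∈ U, IsUnit (1 - β z • T) ∧ S z = H + β z • (G ∘L Ring.inverse (1 - β z • T) ∘L F))
    {z w : ℂ} (hz : z ∈ U) (hw : w ∈ U) (c d : C) :
    form (diskKernel β S z w c) d =
      form (adj (G ∘L Ring.inverse (1 - β w • T)) c) (adj (G ∘L Ring.inverse (1 - β z • T)) d) := by
  let x : ℂ → C → P := fun w c => adj (G ∘L Ring.inverse (1 - β w • T)) c
  have key : ∀ w ∈ U, ∀ c, adj (colligation T F G H) (WithLp.toLp 2 (conj (β w) • x w c, c)) =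
      WithLp.toLp 2 (x w c, adj (S w) c) := fun w hw c => by
    refine eq_of_form_eq fun y => ?_
    obtain ⟨f, d⟩ := y
    obtain ⟨hu, hS⟩ := h w hw
    set R := Ring.inverse (1 - β w • T) with hR
    -- The resolvent identity matches the P-components; the D-component is the formula for S(w).
    have hRT : ∀ p, β w • R (T p) + p = R p := fun p => by
      have : R p - β w • R (T p) = p := by
        simpa using congrArg (fun X : P →L[ℂ] P => X p) (Ring.inverse_mul_cancel _ hu)
      exact (eq_add_of_sub_eq' this).symm
    rw [← form_adj_right, colligation_apply, form_toLp, form_toLp]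
    simp only [x, map_smulₛₗ, Complex.conj_conj, smul_eq_mul, ← form_adj_right, hS,
      ContinuousLinearMap.comp_apply, ← hR]
    rw [← hRT f]
    simp
    ring
  have hiso := hM.form_adj (WithLp.toLp 2 (conj (β w) • x w c, c))
    (WithLp.toLp 2 (conj (β z) • x z d, d))
  rw [key w hw, key z hz, form_toLp, form_toLp] at hiso
  simp only [map_smulₛₗ, LinearMap.smul_apply, smul_eq_mul, RingHom.id_apply,
    Complex.conj_conj] at hiso
  rw [form_diskKernel, inv_mul_eq_iff_eq_mul₀ (one_sub_mul_conj_ne_zero (hβ1 z hz) (hβ1 w hw))]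
  linear_combination -hiso

/-- Each kernel matrix is a Gram matrix in the state space, so the eigenvalue counts are bounded by
n and κ is their maximum. It can be smaller than n. -/
theorem hasNegativeSquares_of_hasDiskRealization (hβ1 : ∀ z ∈ U, ‖β z‖ < 1) {n : ℕ}
    (h : HasDiskRealization.{u, v, w} β U S n) :
    ∃ κ ≤ n, HasNegativeSquares (diskKernel β S) U κ := by
  obtain ⟨P, i1, i2, i3, i4, T, F, G, H, rfl, hM, hS⟩ := h
  have herm : ∀ z ∈ U, ∀ w ∈ U, diskKernel β S z w = adj (diskKernel β S w z) :=
    fun z _ w _ => diskKernel_eq_adj β S z w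
  have hle : ∀ (N : ℕ) (w : Fin N → ℂ) (hw : ∀ i, w i ∈ U) (c : Fin N → C),
      negEigenvalueCount (kernelMatrix_isHermitian herm hw c) ≤ negIndex P :=
    fun N w hw c => negEigenvalueCount_le_of_gram negBound_form _ fun l k =>
      form_diskKernel_eq_of_realization hM hβ1 hS (hw l) (hw k) (c k) (c l)
  let s : Set ℕ := {m | ∃ (N : ℕ) (w : Fin N → ℂ) (hw : ∀ i, w i ∈ U) (c : Fin N → C),
    negEigenvalueCount (kernelMatrix_isHermitian herm hw c) = m}
  have hs : s.Nonempty := ⟨_, 0, Fin.elim0, fun i => i.elim0, Fin.elim0, rfl⟩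
  have hb : negIndex P ∈ upperBounds s := by
    rintro _ ⟨N, w, hw, c, rfl⟩
    exact hle N w hw c
  exact ⟨sSup s, csSup_le hs hb, herm, fun N w hw c => le_csSup ⟨_, hb⟩ ⟨N, w, hw, c, rfl⟩,
    Nat.sSup_mem hs ⟨_, hb⟩⟩

end Realization

/-! ### Invariance of the number of negative squares -/

section Rescaling

variable {C : Type*} [NormedAddCommGroup C] [InnerProductSpace ℂ C] [CompleteSpace C]
  [PontryaginSpace C]

theorem negEigenvalueCount_congr {N : ℕ} {M M' : Matrix (Fin N) (Fin N) ℂ} (h : M = M')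
    (hM : M.IsHermitian) (hM' : M'.IsHermitian) :
    negEigenvalueCount hM = negEigenvalueCount hM' := by
  subst h; rfl

/-- Multiplication of a kernel by `φ(z) conj φ(w)` preserves the number of negative squares. -/
theorem HasNegativeSquares.rescale {K K' : ℂ → ℂ → C →L[ℂ] C} {U : Set ℂ} {κ : ℕ}
    (h : HasNegativeSquares K U κ) {φ : ℂ → ℂ} (hφ : ∀ z ∈ U, φ z ≠ 0)
    (hK : ∀ z ∈ U, ∀ w ∈ U, K' z w = (φ z * conj (φ w)) • K z w) :
    HasNegativeSquares K' U κ := by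
  -- The scalar factor moves into the vectors, so both kernels have the same family of matrices.
  have hmat : ∀ {N : ℕ} (w : Fin N → ℂ), (∀ i, w i ∈ U) → ∀ c : Fin N → C,
      kernelMatrix K' w c = kernelMatrix K w fun k => conj (φ (w k)) • c k := fun w hw c => by
    ext l k
    simp [kernelMatrix, hK _ (hw l) _ (hw k), mul_assoc]
  have herm : ∀ z ∈ U, ∀ w ∈ U, K' z w = adj (K' w z) := fun z hz w hw =>
    adj_unique _ _ fun x y => by
      rw [hK z hz w hw, hK w hw z hz, h.hermitian z hz w hw]
      simp [form_adj_right, mul_comm]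
  refine ⟨herm, fun N w hw c => ?_, ?_⟩
  · rw [negEigenvalueCount_congr (hmat w hw c) _ (kernelMatrix_isHermitian h.hermitian hw _)]
    exact h.count_le N w hw _
  · obtain ⟨N, w, hw, c, hc⟩ := h.exists_count_eq
    refine ⟨N, w, hw, fun k => (conj (φ (w k)))⁻¹ • c k, ?_⟩
    rw [← hc]
    refine negEigenvalueCount_congr ((hmat w hw _).trans ?_) _ _
    congr 1
    ext k
    exact smul_inv_smul₀ (by simpa using hφ _ (hw k)) _

theorem HasNegativeSquares.unique {K : ℂ → ℂ → C →L[ℂ] C} {U : Set ℂ} {κ κ' : ℕ}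
    (h : HasNegativeSquares K U κ) (h' : HasNegativeSquares K U κ') : κ = κ' := by
  obtain ⟨N, w, hw, c, hc⟩ := h.exists_count_eq
  obtain ⟨N', w', hw', c', hc'⟩ := h'.exists_count_eq
  exact le_antisymm (hc ▸ h'.count_le N w hw c) (hc' ▸ h.count_le N' w' hw' c')

end Rescaling

/-! ### The function b_σ on Ω₊ -/

section BSigma

variable {Ω U : Set ℂ} {a b : ℂ → ℂ} {α z w : ℂ}

theorem ne_zero_of_mem_omegaPlus (hz : z ∈ omegaPlus Ω a b) : a z ≠ 0 :=
  norm_pos_iff.1 ((norm_nonneg _).trans_lt hz.2)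

theorem norm_div_lt_one_of_mem_omegaPlus (hz : z ∈ omegaPlus Ω a b) : ‖b z / a z‖ < 1 := by
  rw [norm_div, div_lt_one (norm_pos_iff.2 (ne_zero_of_mem_omegaPlus hz))]
  exact hz.2

theorem bSigma_self : bSigma a b α α = 0 := by simp [bSigma]

/-- The polarized Schwarz–Pick identity for the disk automorphism taking σ(α) to 0. Its diagonal
gives |b_σ| < 1, and its full form gives the rescaling of the kernel. -/
theorem one_sub_bSigma_mul_conj (hα : α ∈ omegaPlus Ω a b) (hz : z ∈ omegaPlus Ω a b)
    (hw : w ∈ omegaPlus Ω a b) :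
    1 - bSigma a b α z * conj (bSigma a b α w) =
      (1 - b α / a α * conj (b α / a α)) * (1 - b z / a z * conj (b w / a w)) /
        ((1 - b z / a z * conj (b α / a α)) * conj (1 - b w / a w * conj (b α / a α))) := by
  have h1 := norm_div_lt_one_of_mem_omegaPlus hα
  have h2 := norm_div_lt_one_of_mem_omegaPlus hz
  have h3 := norm_div_lt_one_of_mem_omegaPlus hw
  unfold bSigma
  generalize b α / a α = s at *
  generalize b z / a z = x at *
  generalize b w / a w = y at *
  have h4 := one_sub_mul_conj_ne_zero h2 h1
  have h5 : conj (1 - y * conj s) ≠ 0 :=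
    (map_ne_zero _).2 (one_sub_mul_conj_ne_zero h3 h1)
  rw [map_div₀, div_mul_div_comm, eq_div_iff (mul_ne_zero h4 h5), sub_mul,
    div_mul_cancel₀ _ (mul_ne_zero h4 h5)]
  simp
  ring

theorem norm_bSigma_lt_one (hα : α ∈ omegaPlus Ω a b) (hz : z ∈ omegaPlus Ω a b) :
    ‖bSigma a b α z‖ < 1 := by
  have h := one_sub_bSigma_mul_conj hα hz hz
  have h1 := norm_div_lt_one_of_mem_omegaPlus hα
  have h2 := norm_div_lt_one_of_mem_omegaPlus hz
  have h4 := one_sub_mul_conj_ne_zero h2 h1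
  rw [Complex.mul_conj', Complex.mul_conj', Complex.mul_conj', Complex.mul_conj'] at h
  have h5 : 1 - ‖bSigma a b α z‖ ^ 2 = (1 - ‖b α / a α‖ ^ 2) * (1 - ‖b z / a z‖ ^ 2) /
      ‖1 - b z / a z * conj (b α / a α)‖ ^ 2 := by exact_mod_cast h
  have h6 : 0 < 1 - ‖bSigma a b α z‖ ^ 2 := by
    rw [h5]
    have e1 : 0 < 1 - ‖b α / a α‖ ^ 2 := by nlinarith [norm_nonneg (b α / a α)]
    have e2 : 0 < 1 - ‖b z / a z‖ ^ 2 := by nlinarith [norm_nonneg (b z / a z)]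
    have e3 := norm_pos_iff.2 h4
    positivity
  nlinarith [norm_nonneg (bSigma a b α z)]

theorem div_eq_of_bSigma_eq (hα : α ∈ omegaPlus Ω a b) (hz : z ∈ omegaPlus Ω a b)
    (hw : w ∈ omegaPlus Ω a b) (h : bSigma a b α z = bSigma a b α w) :
    b z / a z = b w / a w := by
  have h1 := norm_div_lt_one_of_mem_omegaPlus hα
  have h2 := norm_div_lt_one_of_mem_omegaPlus hz
  have h3 := norm_div_lt_one_of_mem_omegaPlus hw
  unfold bSigma at h
  generalize b α / a α = s at *
  generalize b z / a z = x at *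
  generalize b w / a w = y at *
  rw [div_eq_div_iff (one_sub_mul_conj_ne_zero h2 h1) (one_sub_mul_conj_ne_zero h3 h1)] at h
  have h4 : (x - y) * (1 - s * conj s) = 0 := by linear_combination h
  exact sub_eq_zero.1 ((mul_eq_zero.1 h4).resolve_right (one_sub_mul_conj_ne_zero h1 h1))

theorem differentiableOn_bSigma (ha : AnalyticOnNhd ℂ a Ω)
    (hb : AnalyticOnNhd ℂ b Ω) (hUΩ : U ⊆ omegaPlus Ω a b) (hα : α ∈ U) :
    DifferentiableOn ℂ (bSigma a b α) U := by
  have hσ : DifferentiableOn ℂ (fun z => b z / a z) U := fun z hz =>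
    ((hb z (hUΩ hz).1).differentiableAt.div (ha z (hUΩ hz).1).differentiableAt
      (ne_zero_of_mem_omegaPlus (hUΩ hz))).differentiableWithinAt
  exact (hσ.sub_const _).div ((differentiableOn_const _).sub (hσ.mul_const _)) fun z hz =>
    one_sub_mul_conj_ne_zero (norm_div_lt_one_of_mem_omegaPlus (hUΩ hz))
      (norm_div_lt_one_of_mem_omegaPlus (hUΩ hα))

/-- The function `b_σ` is not constant on any nonempty open subset of `U`. -/
theorem dense_bSigma_ne (hΩc : IsConnected Ω) (ha : AnalyticOnNhd ℂ a Ω)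
    (hb : AnalyticOnNhd ℂ b Ω) (hminus : (omegaMinus Ω a b).Nonempty) (hU : IsOpen U)
    (hUΩ : U ⊆ omegaPlus Ω a b) (hα : α ∈ U) (w : U) :
    Dense {z : U | bSigma a b α z ≠ bSigma a b α w} := by
  rw [← compl_compl {z : U | bSigma a b α z ≠ bSigma a b α w}, ← interior_eq_empty_iff_dense_compl,
    Set.eq_empty_iff_forall_notMem]
  intro z hz
  rw [mem_interior_iff_mem_nhds] at hz
  -- Clearing the denominator avoids the zeros of a, so the identity theorem applies on all of Ω; U
  -- itself may be disconnected.
  let g : ℂ → ℂ := fun y => b y * a w - b w * a y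
  have hg : AnalyticOnNhd ℂ g Ω := (hb.mul analyticOnNhd_const).sub (analyticOnNhd_const.mul ha)
  have hgz : ∀ᶠ y in nhds (z : ℂ), g y = 0 := by
    have h1 := (hU.isOpenEmbedding_subtypeVal.image_mem_nhds).2 hz
    filter_upwards [h1] with y hy
    obtain ⟨y, hy, rfl⟩ := hy
    have hy' : bSigma a b α y = bSigma a b α w := by simpa using hy
    have h2 := div_eq_of_bSigma_eq (hUΩ hα) (hUΩ y.2) (hUΩ w.2) hy'
    rw [div_eq_div_iff (ne_zero_of_mem_omegaPlus (hUΩ y.2))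
      (ne_zero_of_mem_omegaPlus (hUΩ w.2))] at h2
    exact sub_eq_zero.2 h2
  have hg0 := hg.eqOn_zero_of_preconnected_of_eventuallyEq_zero hΩc.isPreconnected
    (hUΩ z.2).1 hgz
  -- In Ω_- one has |b(y)| > |a(y)|, while |a(w)| > |b(w)|, so b(y)a(w) and b(w)a(y) cannot be
  -- equal.
  obtain ⟨y, hyΩ, hy⟩ := hminus
  have h3 : b y * a w = b w * a y := sub_eq_zero.1 (hg0 hyΩ)
  have h4 := congrArg norm h3
  rw [norm_mul, norm_mul] at h4
  have h5 := (hUΩ w.2).2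
  nlinarith [norm_nonneg (a y), norm_nonneg (b w)]

/-- The factor `φ` with `K_S(z, w) = φ(z) conj φ(w) (I - S(z) S(w)^*) / (1 - b_σ(z) conj b_σ(w))`. -/
noncomputable def bSigmaFactor (a b : ℂ → ℂ) (α z : ℂ) : ℂ :=
  (√(1 - ‖b α / a α‖ ^ 2) : ℝ) / (a z * (1 - b z / a z * conj (b α / a α)))

theorem bSigmaFactor_ne_zero (hα : α ∈ omegaPlus Ω a b) (hz : z ∈ omegaPlus Ω a b) :
    bSigmaFactor a b α z ≠ 0 := by
  have h1 := norm_div_lt_one_of_mem_omegaPlus hα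
  have e1 : 0 < 1 - ‖b α / a α‖ ^ 2 := by nlinarith [norm_nonneg (b α / a α)]
  exact div_ne_zero (by exact_mod_cast (Real.sqrt_pos.2 e1).ne')
    (mul_ne_zero (ne_zero_of_mem_omegaPlus hz)
      (one_sub_mul_conj_ne_zero (norm_div_lt_one_of_mem_omegaPlus hz) h1))

theorem inv_schurKernel_denominator (hα : α ∈ omegaPlus Ω a b) (hz : z ∈ omegaPlus Ω a b)
    (hw : w ∈ omegaPlus Ω a b) :
    (a z * conj (a w) - b z * conj (b w))⁻¹ =
      bSigmaFactor a b α z * conj (bSigmaFactor a b α w) *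
        (1 - bSigma a b α z * conj (bSigma a b α w))⁻¹ := by
  have h1 := norm_div_lt_one_of_mem_omegaPlus hα
  have h2 := norm_div_lt_one_of_mem_omegaPlus hz
  have h3 := norm_div_lt_one_of_mem_omegaPlus hw
  have haz := ne_zero_of_mem_omegaPlus hz
  have haw : conj (a w) ≠ 0 := by simpa using ne_zero_of_mem_omegaPlus hw
  have e1 : 0 ≤ 1 - ‖b α / a α‖ ^ 2 := by nlinarith [norm_nonneg (b α / a α)]
  have hden : a z * conj (a w) - b z * conj (b w) =
      a z * conj (a w) * (1 - b z / a z * conj (b w / a w)) := by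
    rw [map_div₀]; field_simp
  have hr : ((√(1 - ‖b α / a α‖ ^ 2) : ℝ) : ℂ) * (√(1 - ‖b α / a α‖ ^ 2) : ℝ) =
      1 - b α / a α * conj (b α / a α) := by
    rw [← Complex.ofReal_mul, Real.mul_self_sqrt e1, Complex.mul_conj']
    push_cast; rfl
  have hw' : conj (bSigmaFactor a b α w) = (√(1 - ‖b α / a α‖ ^ 2) : ℝ) /
      (conj (a w) * conj (1 - b w / a w * conj (b α / a α))) := by
    rw [bSigmaFactor, map_div₀, Complex.conj_ofReal, map_mul]
  rw [hden, one_sub_bSigma_mul_conj hα hz hw, hw', bSigmaFactor, div_mul_div_comm, hr]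
  have h4 := one_sub_mul_conj_ne_zero h2 h1
  have h5 : conj (1 - b w / a w * conj (b α / a α)) ≠ 0 :=
    (map_ne_zero _).2 (one_sub_mul_conj_ne_zero h3 h1)
  have h6 := one_sub_mul_conj_ne_zero h2 h3
  have h7 := one_sub_mul_conj_ne_zero h1 h1
  generalize 1 - b z / a z * conj (b α / a α) = p at *
  generalize conj (1 - b w / a w * conj (b α / a α)) = q at *
  generalize 1 - b z / a z * conj (b w / a w) = r at *
  generalize 1 - b α / a α * conj (b α / a α) = t at *
  field_simp

end BSigma

/-! ### Transfer to K_S and conclusion -/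

section Schur

variable {C : Type u} {D : Type v}
  [NormedAddCommGroup C] [InnerProductSpace ℂ C] [CompleteSpace C] [PontryaginSpace C]
  [NormedAddCommGroup D] [InnerProductSpace ℂ D] [CompleteSpace D] [PontryaginSpace D]

theorem hasNegativeSquares_schurKernel_iff {Ω U : Set ℂ} {a b : ℂ → ℂ} {α : ℂ}
    (hUΩ : U ⊆ omegaPlus Ω a b) (hα : α ∈ U) (S : ℂ → D →L[ℂ] C) (κ : ℕ) :
    HasNegativeSquares (schurKernel a b S) U κ ↔
      HasNegativeSquares (diskKernel (bSigma a b α) S) U κ := by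
  have hφ : ∀ z ∈ U, bSigmaFactor a b α z ≠ 0 := fun z hz =>
    bSigmaFactor_ne_zero (hUΩ hα) (hUΩ hz)
  have key : ∀ z ∈ U, ∀ w ∈ U, schurKernel a b S z w =
      (bSigmaFactor a b α z * conj (bSigmaFactor a b α w)) • diskKernel (bSigma a b α) S z w :=
    fun z hz w hw => by
      rw [schurKernel, inv_schurKernel_denominator (hUΩ hα) (hUΩ hz) (hUΩ hw), mul_smul,
        diskKernel]
  refine ⟨fun h => h.rescale (φ := fun z => (bSigmaFactor a b α z)⁻¹)
    (fun z hz => inv_ne_zero (hφ z hz)) fun z hz w hw => ?_, fun h => h.rescale hφ key⟩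
  have hw' : conj (bSigmaFactor a b α w) ≠ 0 := by simpa using hφ w hw
  rw [key z hz w hw, smul_smul, map_inv₀, ← mul_inv,
    inv_mul_cancel₀ (mul_ne_zero (hφ z hz) hw'), one_smul]

end Schur

theorem proposition3p2
    (Ω : Set ℂ) (hΩ : IsOpen Ω) (hΩc : IsConnected Ω)
    (a b : ℂ → ℂ) (ha : AnalyticOnNhd ℂ a Ω) (hb : AnalyticOnNhd ℂ b Ω)
    (hplus : (omegaPlus Ω a b).Nonempty) (hminus : (omegaMinus Ω a b).Nonempty)
    (C : Type u) [NormedAddCommGroup C] [InnerProductSpace ℂ C] [CompleteSpace C]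
    [PontryaginSpace C]
    (D : Type v) [NormedAddCommGroup D] [InnerProductSpace ℂ D] [CompleteSpace D]
    [PontryaginSpace D]
    (hCD : PontryaginSpace.negIndex C = PontryaginSpace.negIndex D)
    (U : Set ℂ) (hU : IsOpen U) (hUΩ : U ⊆ omegaPlus Ω a b)
    (α : ℂ) (hα : α ∈ U) (S : ℂ → D →L[ℂ] C) :
    ((∃ κ, IsGeneralizedSchur a b U S κ) ↔
      ∃ κ, HasCoisometricRealization.{u, v, max u w} a b α U S κ) ∧
    ∀ κ, IsGeneralizedSchur a b U S κ ↔
      IsLeast {n | HasCoisometricRealization.{u, v, max u w} a b α U S n} κ := by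
  have hβ := differentiableOn_bSigma ha hb hUΩ hα
  have hβ1 : ∀ z ∈ U, ‖bSigma a b α z‖ < 1 := fun z hz => norm_bSigma_lt_one (hUΩ hα) (hUΩ hz)
  have realize : ∀ κ, IsGeneralizedSchur a b U S κ →
      HasCoisometricRealization.{u, v, max u w} a b α U S κ := fun κ h =>
    hasDiskRealization_of_hasNegativeSquares hCD hβ.continuousOn hβ1
      (dense_bSigma_ne hΩc ha hb hminus hU hUΩ hα) (α := ⟨α, hα⟩) bSigma_self h.1.continuousOn
      ((hasNegativeSquares_schurKernel_iff hUΩ hα S κ).1 h.2)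
  have schur : ∀ n, HasCoisometricRealization.{u, v, max u w} a b α U S n →
      ∃ κ ≤ n, IsGeneralizedSchur a b U S κ := fun n h => by
    obtain ⟨κ, hκ, hK⟩ := hasNegativeSquares_of_hasDiskRealization hβ1 h
    refine ⟨κ, hκ, ?_, (hasNegativeSquares_schurKernel_iff hUΩ hα S κ).2 hK⟩
    obtain ⟨P, i1, i2, i3, i4, T, F, G, H, -, -, hS⟩ := h
    exact ((differentiableOn_realization F G H hβ fun z hz => (hS z hz).1).congr
      fun z hz => (hS z hz).2).analyticOnNhd hU
  refine ⟨⟨fun ⟨κ, h⟩ => ⟨κ, realize κ h⟩, fun ⟨n, h⟩ => ?_⟩, fun κ => ⟨fun h => ⟨realize κ h,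
    fun n hn => ?_⟩, fun h => ?_⟩⟩
  · obtain ⟨κ, -, hκ⟩ := schur n h
    exact ⟨κ, hκ⟩
  · obtain ⟨κ', hκ', h'⟩ := schur n hn
    exact (h.2.unique h'.2).trans_le hκ'
  -- A realization of least index κ gives κ' ≤ κ negative squares. These yield a realization of
  -- index κ', so κ ≤ κ'.
  · obtain ⟨κ', hκ', h'⟩ := schur κ h.1
    rwa [le_antisymm (h.2 (realize κ' h')) hκ']
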